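/- Let $\mathbb{C}[[x,y]]$ be the ring of formal power series in local coordinates $(x,y)$ centered at $p\in\mathbb{C}^2$. For $g,h\in\mathbb{C}[[x,y]]$ and curves $C: g=0$, $D: h=0$ at $p$, let $i_p(C,D)=\dim_{\mathbb{C}}\mathbb{C}[[x,y]]/(g,h)\in\mathbb{N}\cup\{\infty\}$ be their intersection number, and for a curve $C: f=0$ let $\mu_p(C)=\dim_{\mathbb{C}}\mathbb{C}[[x,y]]/(\partial_x f,\partial_y f)$ be its Milnor number. Let $C: f(x,y)=0$ be a germ of a reduced (holomorphic or formal) curve at $(\mathbb{C}^2,p)$; that is, $f\in\mathbb{C}[[x,y]]$ is nonzero, has zero constant term and has no multiple irreducible factors. Let $C=\bigcup_{j=1}^{\ell}C_j$ be its decomposition into irreducible components $C_j: f_j(x,y)=0$, where $f=f_1\cdots f_\ell$ and each $f_j$ is irreducible in $\mathbb{C}[[x,y]]$. Then $\mu_p(C)$ is finite and \[ \mu_p(C)+\ell-1=\sum_{j=1}^{\ell}\mu_p(C_j)+2\sum_{1\le i<j\le \ell} i_p(C_i,C_j); \] in particular all the terms are finite. -/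

import Mathlib

/-- The ring `ℂ⟦x, y⟧` of formal power series in local coordinates `x = X 0`, `y = X 1` centred
at the point `p`. A plane curve germ `C : f = 0` at `p` is given by its equation `f`. -/
abbrev PlaneSeries : Type := MvPowerSeries (Fin 2) ℂ

/-- The intersection number `i_p(C, D) = dim_ℂ ℂ⟦x, y⟧ / (g, h)` of the curves `C : g = 0` and
`D : h = 0`, with value `⊤` when this dimension is infinite. -/
noncomputable def intersectionNumber (g h : PlaneSeries) : ℕ∞ :=
  Cardinal.toENat (Module.rank ℂ (PlaneSeries ⧸ Ideal.span ({g, h} : Set PlaneSeries)))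

/-- The Milnor number `μ_p(C) = i_p(∂f/∂x, ∂f/∂y)` of the curve `C : f = 0`. -/
noncomputable def milnorNumber (f : PlaneSeries) : ℕ∞ :=
  intersectionNumber (MvPowerSeries.pderiv ℂ 0 f) (MvPowerSeries.pderiv ℂ 1 f)

/-! Write x = `C X` and y = `X` in `K⟦X⟧⟦X⟧`, and i(g, h) for `quotLength`. If f(0, y) ≠ 0,
Teissier's lemma `quotLength_derivation_add_one` says i(f, f_y) + 1 = μ(f) + i(f, x). Indeed, along
an arc of the polar curve f_y = 0 with x = t^e, the chain rule gives t · d/dt f = e · x f_x, so f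
and x f_x have the same order there; hence i(f_y, f) = i(f_y, x f_x) = i(f_y, x) + i(f_y, f_x), and
i(f_y, x) = i(f, x) - 1. For f = ∏ F_i, additivity and the Leibniz rule give i(f, f_y) = ∑_i (i(F_i,
∂_y F_i) + ∑_{j≠i} i(F_i, F_j)). Applying Teissier's lemma to f and to every F_i, the terms i(·, x)
cancel and the constants 1 leave ℓ - 1. The arcs come from Puiseux's theorem
(`exists_parametrization`), additivity from an exact sequence (`quotLength_prime_mul_left`),
finiteness from Weierstrass preparation (`quotLength_ne_top_of_not_dvd`), and a generic shear
ensures f(0, y) ≠ 0 (`exists_coordinates`). -/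

namespace Polynomial

/-! ### Weierstrass factorization and Hensel's lemma for monic polynomials. -/

variable {A : Type*} [CommRing A]

theorem Monic.taylor {p : A[X]} (hp : p.Monic) (a : A) : (Polynomial.taylor a p).Monic := by
  rw [Monic, leadingCoeff_taylor]; exact hp

theorem coeff_taylor_of_natDegree_eq_add_one {p : A[X]} {n : ℕ} (hn : p.natDegree = n + 1)
    (a : A) : (Polynomial.taylor a p).coeff n = p.coeff n + (n + 1) * p.leadingCoeff * a := by
  have hlt : (hasseDeriv n p).natDegree < 2 := by
    have := natDegree_hasseDeriv_le p n
    omega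
  rw [taylor_coeff, eval_eq_sum_range' hlt, Finset.sum_range_succ, Finset.sum_range_one,
    hasseDeriv_coeff, hasseDeriv_coeff, leadingCoeff, hn, add_comm 1 n]
  simp

variable [IsLocalRing A] [IsAdicComplete (IsLocalRing.maximalIdeal A) A]

open IsLocalRing

/-- A monic polynomial over a complete local ring is divisible, as a polynomial, by the
distinguished polynomial of its Weierstrass factorization. -/
theorem Monic.exists_dvd_isDistinguishedAt {p : A[X]} (hp : p.Monic) :
    ∃ q : A[X], q.IsDistinguishedAt (maximalIdeal A) ∧ q ∣ p ∧
      ∃ u : PowerSeries A, IsUnit u ∧ (p : PowerSeries A) = q * u := by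
  have hmap : (p : PowerSeries A).map (residue A) ≠ 0 := by
    rw [← polynomial_map_coe]
    exact_mod_cast (hp.map (residue A)).ne_zero
  obtain ⟨q, u, H⟩ := PowerSeries.exists_isWeierstrassFactorization hmap
  refine ⟨q, H.isDistinguishedAt, ?_, u, H.isUnit, H.eq_mul⟩
  have hq := H.isDistinguishedAt.monic
  have hqmap : (q : PowerSeries A).map (residue A) ≠ 0 := by
    rw [← polynomial_map_coe]
    exact_mod_cast (hq.map (residue A)).ne_zero
  have hord : ((q : PowerSeries A).map (residue A)).order.toNat = q.natDegree := by
    have h1 : (q : PowerSeries A).IsWeierstrassFactorization q 1 :=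
      ⟨H.isDistinguishedAt, isUnit_one, by simp⟩
    exact h1.natDegree_eq_toNat_order_map.symm
  -- Polynomial division by `q` is also a Weierstrass division, so by uniqueness its remainder is
  -- zero.
  have h1 : (p : PowerSeries A).IsWeierstrassDivision q u 0 :=
    ⟨by simp, by simpa using H.eq_mul⟩
  have h2 : (p : PowerSeries A).IsWeierstrassDivision q (p /ₘ q : A[X]) (p %ₘ q) := by
    refine ⟨?_, ?_⟩
    · change _ < ((((q : PowerSeries A).map (residue A)).order.toNat : ℕ) : WithBot ℕ)
      rw [hord, ← degree_eq_natDegree hq.ne_zero]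
      exact degree_modByMonic_lt p hq
    · rw [← coe_mul, ← coe_add, add_comm, modByMonic_add_div]
  exact (modByMonic_eq_zero_iff_dvd hq).1 (h2.elim hqmap h1).2

/-- A form of Hensel's lemma: a monic polynomial over a complete local ring whose reduction has a
root without being a power of the corresponding linear factor is reducible. -/
theorem Monic.exists_mul_of_eval_mem_maximalIdeal {p : A[X]} (hp : p.Monic) {a : A}
    (ha : p.eval a ∈ maximalIdeal A)
    (hne : p.map (residue A) ≠ (X - C (residue A a)) ^ p.natDegree) :
    ∃ q r : A[X], q.Monic ∧ r.Monic ∧ p = q * r ∧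
      q.natDegree < p.natDegree ∧ r.natDegree < p.natDegree := by
  -- The distinguished factor of p(X + a) is proper: full degree would make the reduction of `p` a
  -- power of X - a, and degree zero would make p(a) a unit.
  obtain ⟨q, hq, ⟨r, hr⟩, u, hu, hqu⟩ := (hp.taylor a).exists_dvd_isDistinguishedAt
  have hrm : r.Monic := hq.monic.of_mul_monic_left (hr ▸ hp.taylor a)
  have hdeg : p.natDegree = q.natDegree + r.natDegree := by
    rw [← natDegree_taylor p a, hr, hq.monic.natDegree_mul hrm]
  have hpq : p = Polynomial.taylor (-a) q * Polynomial.taylor (-a) r := by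
    rw [← taylor_mul, ← hr, taylor_taylor, neg_add_cancel, taylor_zero]
  refine ⟨_, _, hq.monic.taylor (-a), hrm.taylor (-a), hpq, ?_, ?_⟩
  · rw [natDegree_taylor]
    refine lt_of_le_of_ne (by omega) fun h ↦ hne ?_
    have hr1 : r = 1 := by
      rw [← hrm.natDegree_eq_zero]; omega
    have hp' : p = Polynomial.taylor (-a) q := by rw [hpq, hr1]; simp
    have hqm : q.map (residue A) = X ^ q.natDegree := hq.map_eq_X_pow
    rw [← h, hp', map_taylor, hqm, taylor_X_pow]
    simp [sub_eq_add_neg]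
  · rw [natDegree_taylor]
    refine lt_of_le_of_ne (by omega) fun h ↦ ?_
    have hq1 : q = 1 := by
      rw [← hq.monic.natDegree_eq_zero]; omega
    have h0 := congrArg PowerSeries.constantCoeff hqu
    rw [hq1, coe_one, one_mul, ← PowerSeries.coeff_zero_eq_constantCoeff_apply, coeff_coe,
      taylor_coeff_zero] at h0
    rw [h0] at ha
    exact ha (PowerSeries.isUnit_constantCoeff u hu)

end Polynomial

/-! ### Puiseux's theorem for monic polynomials over `K⟦X⟧`. -/

namespace PowerSeries

variable {K : Type*} [Field K]

instance isAdicComplete_maximalIdeal : IsAdicComplete (IsLocalRing.maximalIdeal K⟦X⟧) K⟦X⟧ := by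
  rw [maximalIdeal_eq_span_X]; infer_instance

theorem mem_maximalIdeal_iff_constantCoeff_eq_zero {f : K⟦X⟧} :
    f ∈ IsLocalRing.maximalIdeal K⟦X⟧ ↔ constantCoeff f = 0 := by
  rw [maximalIdeal_eq_span_X, Ideal.mem_span_singleton, X_dvd_iff]

theorem residue_eq_residue_iff {f g : K⟦X⟧} :
    IsLocalRing.residue K⟦X⟧ f = IsLocalRing.residue K⟦X⟧ g ↔
      constantCoeff f = constantCoeff g := by
  rw [← sub_eq_zero, ← map_sub, IsLocalRing.residue_eq_zero_iff,
    mem_maximalIdeal_iff_constantCoeff_eq_zero, map_sub, sub_eq_zero]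

theorem X_pow_dvd_iff_le_order {R : Type*} [Semiring R] {f : R⟦X⟧} {n : ℕ} :
    X ^ n ∣ f ↔ (n : ℕ∞) ≤ f.order := by
  rw [X_pow_dvd_iff]
  exact ⟨fun h ↦ nat_le_order _ _ h,
    fun h m hm ↦ coeff_of_lt_order m (lt_of_lt_of_le (by exact_mod_cast hm) h)⟩

theorem expand_toRingHom_comp (d e : ℕ) (hd : d ≠ 0) (he : e ≠ 0) :
    (expand d hd : K⟦X⟧ →ₐ[K] K⟦X⟧).toRingHom.comp (expand e he).toRingHom =
      (expand (d * e) (mul_ne_zero hd he)).toRingHom :=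
  RingHom.ext fun f ↦ (expand_mul d hd e he f).symm

end PowerSeries

namespace Polynomial

variable {K : Type*} [Field K]

/-- If the coefficient of second highest degree of a monic polynomial `p` over `K⟦X⟧` vanishes and
`p` is not a power of the variable, then after extracting a root of the variable of `K⟦X⟧` one can
rescale the roots of `p` so that its reduction is not a power of the variable either. -/
theorem Monic.exists_expand_eq_scaleRoots {p : (PowerSeries K)[X]} (hp : p.Monic)
    (hne : p ≠ X ^ p.natDegree) :
    ∃ (e : ℕ) (he : e ≠ 0) (r : ℕ) (q : (PowerSeries K)[X]), q.Monic ∧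
      q.natDegree = p.natDegree ∧
      p.map (PowerSeries.expand e he : PowerSeries K →ₐ[K] PowerSeries K).toRingHom =
        q.scaleRoots (PowerSeries.X ^ r) ∧
      q.map (PowerSeries.constantCoeff (R := K)) ≠ X ^ p.natDegree := by
  classical
  set n := p.natDegree with hn
  have he : n.factorial ≠ 0 := n.factorial_ne_zero
  set φ := (PowerSeries.expand n.factorial he : PowerSeries K →ₐ[K] PowerSeries K) with hφ
  -- `P r` is the condition for dividing all roots by X ^ r; the maximal such `r` is the slope of
  -- the Newton polygon, an integer thanks to the exponent n!.
  let P : ℕ → Prop := fun r ↦ ∀ i < n, PowerSeries.X ^ (r * (n - i)) ∣ φ (p.coeff i)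
  obtain ⟨i, hi, hpi⟩ : ∃ i < n, p.coeff i ≠ 0 := by
    by_contra! h
    refine hne (Polynomial.ext fun i ↦ ?_)
    rw [coeff_X_pow]
    rcases lt_trichotomy i n with h1 | h1 | h1
    · rw [h i h1, if_neg h1.ne]
    · rw [if_pos h1, h1]; exact hp
    · rw [if_neg h1.ne', coeff_eq_zero_of_natDegree_lt h1]
  have hφi : (φ (p.coeff i)).order ≠ ⊤ := by
    rw [hφ, PowerSeries.order_expand]
    have : (p.coeff i).order ≠ ⊤ := by simpa using hpi
    lift (p.coeff i).order to ℕ using this with m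
    rw [nsmul_eq_mul]
    exact_mod_cast ENat.natCast_ne_top (n.factorial * m)
  have hP0 : P 0 := fun i _ ↦ by simp
  obtain ⟨r, hr, hr1⟩ : ∃ r, P r ∧ ¬ P (r + 1) := by
    by_contra! h
    have hall : ∀ r, P r := fun r ↦ Nat.rec hP0 h r
    refine hφi (ENat.eq_top_iff_forall_ge.2 fun m ↦ ?_)
    have h1 := hall m i hi
    rw [PowerSeries.X_pow_dvd_iff_le_order] at h1
    refine le_trans ?_ h1
    exact_mod_cast Nat.le_mul_of_pos_right m (by omega)
  choose! b hb using hr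
  set s : (PowerSeries K)[X] := ∑ j ∈ Finset.range n, C (b j) * X ^ j with hs
  have hsdeg : s.degree < n := by
    rw [← Polynomial.mem_degreeLT]
    refine Submodule.sum_mem _ fun j hj ↦ ?_
    rw [Polynomial.mem_degreeLT]
    exact (degree_C_mul_X_pow_le _ _).trans_lt (by exact_mod_cast Finset.mem_range.1 hj)
  have hqm : (X ^ n + s).Monic := monic_X_pow_add hsdeg
  have hqd : (X ^ n + s).natDegree = n := by
    rw [natDegree_add_eq_left_of_degree_lt (by simpa using hsdeg), natDegree_X_pow]
  have hscoeff : ∀ j < n, (X ^ n + s).coeff j = b j := by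
    intro j hj
    rw [coeff_add, coeff_X_pow, if_neg hj.ne, zero_add, hs, finsetSum_coeff]
    simp [coeff_X_pow, hj]
  refine ⟨n.factorial, he, r, X ^ n + s, hqm, hqd, ?_, fun h ↦ hr1 ?_⟩
  · ext1 j
    rw [coeff_map, coeff_scaleRoots, hqd]
    rcases lt_trichotomy j n with h1 | hj | h1
    · rw [hscoeff j h1, ← pow_mul, mul_comm]
      exact hb j h1
    · have h2 : p.coeff n = 1 := hp
      have h3 : (X ^ n + s).coeff n = 1 := by
        have := hqm.coeff_natDegree
        rwa [hqd] at this
      rw [hj, h2, h3]; simp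
    · rw [coeff_eq_zero_of_natDegree_lt h1, coeff_eq_zero_of_natDegree_lt (by rw [hqd]; exact h1)]
      simp
  · intro j hj
    have h0 := congrArg (fun g ↦ coeff g j) h
    simp only [coeff_map, coeff_X_pow, if_neg hj.ne, hscoeff j hj] at h0
    obtain ⟨c, hc⟩ := PowerSeries.X_dvd_iff.2 h0
    have h1 : PowerSeries.X ^ (r * (n - j) + 1) ∣ φ (p.coeff j) :=
      ⟨c, by rw [hb j hj, hc]; ring⟩
    rw [PowerSeries.X_pow_dvd_iff_le_order] at h1 ⊢
    rw [hφ, PowerSeries.order_expand] at h1 ⊢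
    rcases eq_or_ne (p.coeff j).order ⊤ with ht | ht
    · rw [ht, nsmul_eq_mul, ENat.mul_top (by exact_mod_cast he)]; exact le_top
    · lift (p.coeff j).order to ℕ using ht with m
      rw [nsmul_eq_mul] at h1 ⊢
      norm_cast at h1 ⊢
      -- The order of φ(p_j) is a multiple of n - j, so exceeding r(n - j) means reaching (r + 1)(n
      -- - j), against the maximality of `r`.
      obtain ⟨d, hd⟩ : n - j ∣ n.factorial := Nat.dvd_factorial (by omega) (by omega)
      rw [hd] at h1 ⊢
      have h2 : r * (n - j) < d * m * (n - j) := by nlinarith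
      have h3 := lt_of_mul_lt_mul_right h2 (Nat.zero_le _)
      calc (r + 1) * (n - j) ≤ d * m * (n - j) := Nat.mul_le_mul_right _ h3
        _ = (n - j) * d * m := by ring

variable [IsAlgClosed K] [CharZero K]

/-- **Puiseux's theorem**: a monic polynomial over `K⟦X⟧` splits after extracting a root of the
variable of `K⟦X⟧`. -/
theorem Monic.exists_splits_map_expand {p : (PowerSeries K)[X]} (hp : p.Monic) :
    ∃ (e : ℕ) (he : e ≠ 0),
      (p.map (PowerSeries.expand e he : PowerSeries K →ₐ[K] PowerSeries K).toRingHom).Splits := by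
  induction hd : p.natDegree using Nat.strong_induction_on generalizing p with
  | _ d ih =>
  have hmul : ∀ q r : (PowerSeries K)[X], q.Monic → r.Monic → q.natDegree < d →
      r.natDegree < d → ∃ (e : ℕ) (he : e ≠ 0),
      ((q * r).map (PowerSeries.expand e he : PowerSeries K →ₐ[K] PowerSeries K).toRingHom).Splits := by
    intro q r hq hr hqd hrd
    obtain ⟨e₁, he₁, h₁⟩ := ih _ hqd hq rfl
    obtain ⟨e₂, he₂, h₂⟩ := ih _ hrd hr rfl
    refine ⟨e₁ * e₂, mul_ne_zero he₁ he₂, ?_⟩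
    rw [Polynomial.map_mul]
    refine Splits.mul ?_ ?_
    · have := h₁.map (PowerSeries.expand e₂ he₂ : PowerSeries K →ₐ[K] PowerSeries K).toRingHom
      rw [map_map, PowerSeries.expand_toRingHom_comp] at this
      simpa only [mul_comm e₂ e₁] using this
    · have := h₂.map (PowerSeries.expand e₁ he₁ : PowerSeries K →ₐ[K] PowerSeries K).toRingHom
      rwa [map_map, PowerSeries.expand_toRingHom_comp] at this
  rcases d with _ | n
  · exact ⟨1, one_ne_zero, Splits.of_natDegree_eq_zero
      (by rw [hp.natDegree_map, hd])⟩
  -- The Tschirnhaus shift, which kills the coefficient of degree `n`.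
  set a : PowerSeries K := -((n + 1 : K)⁻¹ • p.coeff n) with ha
  have hn0 : (n + 1 : K) ≠ 0 := by exact_mod_cast n.succ_ne_zero
  set q := Polynomial.taylor a p with hq
  have hqm : q.Monic := hp.taylor a
  have hqd : q.natDegree = n + 1 := by rw [hq, natDegree_taylor, hd]
  have hqn : q.coeff n = 0 := by
    rw [hq, coeff_taylor_of_natDegree_eq_add_one hd, hp.leadingCoeff, ha, mul_one, mul_neg]
    have : ((n : PowerSeries K) + 1) = PowerSeries.C (n + 1 : K) := by simp
    rw [this, ← PowerSeries.smul_eq_C_mul, smul_smul, mul_inv_cancel₀ hn0, one_smul,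
      add_neg_cancel]
  suffices ∃ (e : ℕ) (he : e ≠ 0),
      (q.map (PowerSeries.expand e he : PowerSeries K →ₐ[K] PowerSeries K).toRingHom).Splits by
    obtain ⟨e, he, h⟩ := this
    refine ⟨e, he, ?_⟩
    have hpq : p = Polynomial.taylor (-a) q := by
      rw [hq, taylor_taylor, neg_add_cancel, taylor_zero]
    rw [hpq, map_taylor]
    exact h.taylor _
  rcases eq_or_ne q (X ^ q.natDegree) with hqX | hqX
  · refine ⟨1, one_ne_zero, ?_⟩
    rw [hqX, Polynomial.map_pow, map_X]
    exact Splits.X_pow _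
  obtain ⟨e₁, he₁, r, s, hsm, hsd, hs, hsne⟩ := hqm.exists_expand_eq_scaleRoots hqX
  rw [hqd] at hsd hsne
  have hsn : s.coeff n = 0 := by
    have h := congrArg (fun g ↦ coeff g n) hs
    simp only [coeff_map, hqn, coeff_scaleRoots, hsd, map_zero] at h
    exact (mul_eq_zero.1 h.symm).resolve_right (pow_ne_zero _ (pow_ne_zero _ PowerSeries.X_ne_zero))
  obtain ⟨c, hc⟩ := IsAlgClosed.exists_root (s.map (PowerSeries.constantCoeff (R := K))) (by
    rw [hsm.degree_map, degree_eq_natDegree hsm.ne_zero, hsd]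
    exact_mod_cast n.succ_ne_zero)
  have hceval : s.eval (PowerSeries.C c) ∈ IsLocalRing.maximalIdeal (PowerSeries K) := by
    rw [PowerSeries.mem_maximalIdeal_iff_constantCoeff_eq_zero]
    have h := hc.eq_zero
    rw [eval_map] at h
    rw [← h, eval₂_eq_eval_map, ← eval_map_apply, PowerSeries.constantCoeff_C]
  -- If the reduction were (X - c)^(n+1), the vanishing coefficient of degree `n` would force c = 0,
  -- which the choice of rescaling excludes. So Hensel's lemma splits `s`.
  obtain ⟨u, v, hu, hv, huv, hud, hvd⟩ := hsm.exists_mul_of_eval_mem_maximalIdeal hceval (by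
    intro h
    have h' : s.map (PowerSeries.constantCoeff (R := K)) = (X - C c) ^ (n + 1) := by
      ext i
      have h2 := congrArg (fun g ↦ coeff g i) h
      have h3 : (X - C (IsLocalRing.residue (PowerSeries K) (PowerSeries.C c))) ^ s.natDegree =
          ((X - C (PowerSeries.C c)) ^ s.natDegree).map (IsLocalRing.residue _) := by simp
      rw [h3] at h2
      simp only [coeff_map, hsd] at h2
      rw [PowerSeries.residue_eq_residue_iff, ← coeff_map] at h2
      rw [h2, ← coeff_map]
      simp
    have hc0 : c = 0 := by
      have h2 := congrArg nextCoeff h'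
      rw [(monic_X_sub_C c).nextCoeff_pow, nextCoeff_X_sub_C,
        nextCoeff_of_natDegree_pos (by rw [hsm.natDegree_map, hsd]; omega), hsm.natDegree_map,
        hsd, coeff_map, Nat.add_sub_cancel, hsn, map_zero, nsmul_eq_mul] at h2
      have := mul_eq_zero.1 h2.symm
      rw [neg_eq_zero] at this
      exact this.resolve_left (by exact_mod_cast n.succ_ne_zero)
    exact hsne (by simpa [hc0] using h'))
  rw [hsd] at hud hvd
  obtain ⟨e₂, he₂, h₂⟩ := hmul u v hu hv hud hvd
  rw [← huv] at h₂
  refine ⟨e₂ * e₁, mul_ne_zero he₂ he₁, ?_⟩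
  have h3 := h₂.scaleRoots ((PowerSeries.expand e₂ he₂ : PowerSeries K →ₐ[K] PowerSeries K).toRingHom
    (PowerSeries.X ^ r))
  rw [← map_scaleRoots _ _ _ (by rw [hsm.leadingCoeff, map_one]; exact one_ne_zero), ← hs,
    map_map] at h3
  rwa [PowerSeries.expand_toRingHom_comp] at h3

end Polynomial

/-! ### Intersection numbers and their additivity. -/

/-- The dimension `dim_K S / (f, g)` in `ℕ∞`. -/
noncomputable def quotLength (K : Type*) {S : Type*} [Field K] [CommRing S] [Algebra K S]
    (f g : S) : ℕ∞ :=
  Module.length K (S ⧸ Ideal.span ({f, g} : Set S))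

theorem intersectionNumber_eq_quotLength (g h : PlaneSeries) :
    intersectionNumber g h = quotLength ℂ g h :=
  (Module.length_eq_rank _ _).symm

section

variable (K : Type*) {S T : Type*} [Field K] [CommRing S] [Algebra K S] [CommRing T] [Algebra K T]

theorem quotLength_comm (f g : S) : quotLength K f g = quotLength K g f := by
  rw [quotLength, quotLength, Set.pair_comm]

theorem quotLength_le_of_span_le {f g f' g' : S}
    (h : Ideal.span ({f, g} : Set S) ≤ Ideal.span {f', g'}) :
    quotLength K f' g' ≤ quotLength K f g :=
  Module.length_le_of_surjective (Ideal.Quotient.factorₐ K h).toLinearMap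
    (Ideal.Quotient.factor_surjective h)

theorem quotLength_le_of_mem {f g a b : S} (ha : a ∈ Ideal.span ({f, g} : Set S))
    (hb : b ∈ Ideal.span ({f, g} : Set S)) : quotLength K f g ≤ quotLength K a b :=
  quotLength_le_of_span_le K (Ideal.span_le.2 (by rintro _ (rfl | rfl); exacts [ha, hb]))

theorem quotLength_eq_of_mem {f g a b : S} (ha : a ∈ Ideal.span ({f, g} : Set S))
    (hb : b ∈ Ideal.span ({f, g} : Set S)) (hf : f ∈ Ideal.span ({a, b} : Set S))
    (hg : g ∈ Ideal.span ({a, b} : Set S)) : quotLength K f g = quotLength K a b :=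
  (quotLength_le_of_mem K ha hb).antisymm (quotLength_le_of_mem K hf hg)

theorem quotLength_mul_isUnit_left {u : S} (hu : IsUnit u) (f g : S) :
    quotLength K (f * u) g = quotLength K f g := by
  obtain ⟨u, rfl⟩ := hu
  refine quotLength_eq_of_mem K ?_ ?_ ?_ ?_ <;> rw [Ideal.mem_span_pair]
  · exact ⟨↑u⁻¹, 0, by rw [zero_mul, add_zero, mul_comm, mul_assoc, Units.mul_inv, mul_one]⟩
  · exact ⟨0, 1, by ring⟩
  · exact ⟨u, 0, by ring⟩
  · exact ⟨0, 1, by ring⟩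

theorem quotLength_add_mul_right (f g a : S) : quotLength K f (g + f * a) = quotLength K f g := by
  refine quotLength_eq_of_mem K ?_ ?_ ?_ ?_ <;> rw [Ideal.mem_span_pair]
  · exact ⟨1, 0, by ring⟩
  · exact ⟨-a, 1, by ring⟩
  · exact ⟨1, 0, by ring⟩
  · exact ⟨a, 1, by ring⟩

theorem quotLength_of_isUnit_left {f : S} (hf : IsUnit f) (g : S) : quotLength K f g = 0 := by
  rw [quotLength, Module.length_eq_zero_iff, Ideal.Quotient.subsingleton_iff]
  exact Ideal.eq_top_of_isUnit_mem _ (Ideal.subset_span (by simp)) hf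

theorem quotLength_of_dvd {f g : S} (h : f ∣ g) :
    quotLength K f g = Module.length K (S ⧸ Ideal.span {f}) := by
  have : Ideal.span ({f, g} : Set S) = Ideal.span {f} := by
    rw [Ideal.span_insert, sup_eq_left, Ideal.span_singleton_le_span_singleton]; exact h
  rw [quotLength, this]

/-- The dimension of a quotient by an ideal containing the kernel of a surjection. -/
theorem quotLength_eq_of_surjective {θ : S →ₐ[K] T} (hθ : Function.Surjective θ) {p : S}
    (hker : RingHom.ker θ = Ideal.span {p}) (g : S) :
    quotLength K p g = Module.length K (T ⧸ Ideal.span {θ g}) := by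
  have hmap : (Ideal.span ({p, g} : Set S)).map θ = Ideal.span {θ g} := by
    have hp : θ p = 0 := by
      have : p ∈ RingHom.ker θ := hker ▸ Ideal.mem_span_singleton_self p
      exact this
    rw [Ideal.map_span, Set.image_pair, hp, Ideal.span_insert_zero]
  have hle : Ideal.span ({p, g} : Set S) = (Ideal.span {θ g}).comap θ := by
    rw [← hmap, Ideal.comap_map_of_surjective' _ hθ, hker, left_eq_sup]
    exact Ideal.span_mono (by simp)
  let ψ : S →ₐ[K] T ⧸ Ideal.span {θ g} := (Ideal.Quotient.mkₐ K _).comp θ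
  have hψ : Function.Surjective ψ := (Ideal.Quotient.mkₐ_surjective K _).comp hθ
  have hkψ : RingHom.ker ψ = Ideal.span {p, g} := by
    rw [hle]
    ext x
    simp [ψ, RingHom.mem_ker, Ideal.Quotient.eq_zero_iff_mem]
  rw [quotLength, ← hkψ]
  exact (Ideal.quotientKerAlgEquivOfSurjective hψ).toLinearEquiv.length_eq

theorem quotLength_map_algEquiv (e : S ≃ₐ[K] T) (f g : S) :
    quotLength K (e f) (e g) = quotLength K f g := by
  have : Ideal.span {e f, e g} = (Ideal.span {f, g}).map (e : S →+* T) := by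
    rw [Ideal.map_span, Set.image_pair]; rfl
  exact (Ideal.quotientEquivAlg _ _ e this).toLinearEquiv.length_eq.symm

/-- The sequence 0 → S/(f, g) → S/(pf, g) → S/(p, g) → 0, with first map multiplication by p, is
exact; the hypothesis is the injectivity of that map. -/
theorem quotLength_mul_left {p f g : S}
    (h : ∀ u, p * u ∈ Ideal.span ({p * f, g} : Set S) → u ∈ Ideal.span ({f, g} : Set S)) :
    quotLength K (p * f) g = quotLength K p g + quotLength K f g := by
  have hle : Ideal.span ({p * f, g} : Set S) ≤ Ideal.span {p, g} := by
    rw [Ideal.span_le]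
    rintro _ (rfl | rfl)
    · exact Ideal.mul_mem_right _ _ (Ideal.subset_span (by simp))
    · exact Ideal.subset_span (by simp)
  have hle' : Ideal.span ({f, g} : Set S) ≤
      Submodule.comap (LinearMap.mulLeft S p) (Ideal.span ({p * f, g} : Set S)) := by
    rw [Ideal.span_le]
    rintro a (ha | ha)
    · exact Ideal.subset_span (Or.inl (congrArg (p * ·) ha))
    · exact Ideal.mul_mem_left _ p (Ideal.subset_span (Or.inr ha))
  let α : (S ⧸ Ideal.span ({f, g} : Set S)) →ₗ[S] S ⧸ Ideal.span ({p * f, g} : Set S) :=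
    Submodule.mapQ _ _ (LinearMap.mulLeft S p) hle'
  let β := (Ideal.Quotient.factorₐ K hle).toLinearMap
  have hα : Function.Injective (α.restrictScalars K) := by
    rw [← LinearMap.ker_eq_bot, LinearMap.ker_eq_bot']
    intro x hx
    obtain ⟨u, rfl⟩ := Ideal.Quotient.mk_surjective x
    have hx' : Ideal.Quotient.mk (Ideal.span ({p * f, g} : Set S)) (p * u) = 0 := hx
    exact Ideal.Quotient.eq_zero_iff_mem.2 (h u (Ideal.Quotient.eq_zero_iff_mem.1 hx'))
  rw [quotLength, add_comm]
  refine Module.length_eq_add_of_exact (α.restrictScalars K) β hα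
    (Ideal.Quotient.factor_surjective hle) fun y ↦ ⟨fun hy ↦ ?_, ?_⟩
  · obtain ⟨b, rfl⟩ := Ideal.Quotient.mk_surjective y
    have hb : Ideal.Quotient.mk (Ideal.span ({p, g} : Set S)) b = 0 := hy
    rw [Ideal.Quotient.eq_zero_iff_mem, Ideal.mem_span_pair] at hb
    obtain ⟨a, c, rfl⟩ := hb
    refine ⟨Ideal.Quotient.mk _ a, ?_⟩
    change Ideal.Quotient.mk (Ideal.span ({p * f, g} : Set S)) (p * a) = _
    rw [Ideal.Quotient.mk_eq_mk_iff_sub_mem, Ideal.mem_span_pair]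
    exact ⟨0, -c, by ring⟩
  · rintro ⟨x, rfl⟩
    obtain ⟨u, rfl⟩ := Ideal.Quotient.mk_surjective x
    change Ideal.Quotient.mk (Ideal.span ({p, g} : Set S)) (p * u) = 0
    rw [Ideal.Quotient.eq_zero_iff_mem, Ideal.mem_span_pair]
    exact ⟨u, 0, by ring⟩

variable [IsDomain S]

/-- Additivity of intersection numbers in a factor that is prime and has infinite-dimensional
coordinate ring. -/
theorem quotLength_prime_mul_left {p : S} (hp : Prime p)
    (htop : Module.length K (S ⧸ Ideal.span {p}) = ⊤) (f g : S) :
    quotLength K (p * f) g = quotLength K p g + quotLength K f g := by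
  by_cases hpg : p ∣ g
  · have h1 : quotLength K p g = ⊤ := by rw [quotLength_of_dvd K hpg, htop]
    have h2 : quotLength K p g ≤ quotLength K (p * f) g :=
      quotLength_le_of_mem K (Ideal.mem_span_pair.2 ⟨f, 0, by ring⟩)
        (Ideal.mem_span_pair.2 ⟨0, 1, by ring⟩)
    rw [h1, top_le_iff] at h2
    rw [h1, h2, top_add]
  · refine quotLength_mul_left K fun u hu ↦ ?_
    obtain ⟨a, b, hab⟩ := Ideal.mem_span_pair.1 hu
    obtain ⟨c, rfl⟩ : p ∣ b := by
      refine (hp.dvd_or_dvd (?_ : p ∣ b * g)).resolve_right hpg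
      exact ⟨u - a * f, by linear_combination hab⟩
    refine Ideal.mem_span_pair.2 ⟨a, c, mul_left_cancel₀ hp.ne_zero ?_⟩
    linear_combination hab

/-- Additivity of intersection numbers over a product of primes. -/
theorem quotLength_multiset_prod_left {ι : Type*} (s : Multiset ι) (p : ι → S)
    (hp : ∀ i ∈ s, Prime (p i))
    (htop : ∀ i ∈ s, Module.length K (S ⧸ Ideal.span {p i}) = ⊤) (g : S) :
    quotLength K (s.map p).prod g = (s.map fun i ↦ quotLength K (p i) g).sum := by
  induction s using Multiset.induction_on with
  | empty => simpa using quotLength_of_isUnit_left K isUnit_one g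
  | cons i s ih =>
    rw [Multiset.map_cons, Multiset.prod_cons, Multiset.map_cons, Multiset.sum_cons,
      quotLength_prime_mul_left K (hp i (by simp)) (htop i (by simp)),
      ih (fun j hj ↦ hp j (by simp [hj])) (fun j hj ↦ htop j (by simp [hj]))]

theorem quotLength_finset_prod_left {ι : Type*} (s : Finset ι) (p : ι → S)
    (hp : ∀ i ∈ s, Prime (p i))
    (htop : ∀ i ∈ s, Module.length K (S ⧸ Ideal.span {p i}) = ⊤) (g : S) :
    quotLength K (∏ i ∈ s, p i) g = ∑ i ∈ s, quotLength K (p i) g :=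
  quotLength_multiset_prod_left K s.1 p hp htop g

end

/-! ### Dimensions of quotients of `K⟦X⟧`. -/

namespace PowerSeries

variable {K : Type*} [Field K]

theorem length_quotient_span_X_pow (n : ℕ) :
    Module.length K (K⟦X⟧ ⧸ Ideal.span {(X : K⟦X⟧) ^ n}) = n := by
  have hX : Module.length K (K⟦X⟧ ⧸ Ideal.span {(X : K⟦X⟧)}) = 1 := by
    have hs : Function.Surjective (constantCoeff : K⟦X⟧ →+* K) := constantCoeff_surj
    let θ : K⟦X⟧ →ₐ[K] K := ⟨constantCoeff, fun r ↦ by simp⟩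
    have hk : RingHom.ker θ = Ideal.span {X} := by
      ext f
      rw [RingHom.mem_ker, Ideal.mem_span_singleton, X_dvd_iff]; rfl
    have h := quotLength_eq_of_surjective K (θ := θ) hs hk 0
    rw [quotLength_of_dvd K (dvd_zero _), map_zero] at h
    rw [h, Ideal.span_singleton_zero,
      (AlgEquiv.quotientBot K K).toLinearEquiv.length_eq, Module.length_eq_one]
  induction n with
  | zero =>
    rw [pow_zero, Ideal.span_singleton_one, Module.length_eq_zero_iff.2]
    · rfl
    · exact Ideal.Quotient.subsingleton_iff.2 rfl
  | succ n ih =>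
    have h : quotLength K ((X : K⟦X⟧) * X ^ n) 0 = _ := quotLength_mul_left K fun u hu ↦ by
      obtain ⟨a, b, hab⟩ := Ideal.mem_span_pair.1 hu
      exact Ideal.mem_span_pair.2 ⟨a, 0, mul_left_cancel₀ (X_ne_zero (R := K)) (by
        linear_combination hab)⟩
    rw [quotLength_of_dvd K (dvd_zero _), quotLength_of_dvd K (dvd_zero _),
      quotLength_of_dvd K (dvd_zero _), ih, hX, ← pow_succ'] at h
    rw [h, Nat.cast_add, Nat.cast_one, add_comm]

theorem length_quotient_span_singleton (f : K⟦X⟧) :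
    Module.length K (K⟦X⟧ ⧸ Ideal.span {f}) = f.order := by
  rcases eq_or_ne f 0 with rfl | hf
  · rw [order_zero, ENat.eq_top_iff_forall_ge]
    intro n
    rw [← length_quotient_span_X_pow (K := K) n, ← quotLength_of_dvd K (dvd_zero _),
      ← quotLength_of_dvd K (dvd_zero _)]
    exact quotLength_le_of_mem K (Ideal.zero_mem _) (Ideal.zero_mem _)
  · have hfu : X ^ f.order.toNat * (Unit_of_divided_by_X_pow_order f : K⟦X⟧) = f := by
      rw [Unit_of_divided_by_X_pow_order_nonzero hf, X_pow_order_mul_divXPowOrder]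
    have hspan : Ideal.span {f} = Ideal.span {(X : K⟦X⟧) ^ f.order.toNat} := by
      conv_lhs => rw [← hfu]
      exact Ideal.span_singleton_mul_right_unit (Units.isUnit _) _
    rw [hspan, length_quotient_span_X_pow]
    exact coe_toNat_order hf

end PowerSeries

/-! ### Derivations and homomorphisms determined by their values on generators. -/

/-- A twisted derivation which vanishes on topological generators vanishes. -/
theorem LinearMap.eq_zero_of_twisted_leibniz {K A B : Type*} [CommRing K] [CommRing A]
    [CommRing B] [Algebra K A] [Algebra K B] (δ : A →ₗ[K] B) (φ ψ : A →ₐ[K] B)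
    (hδ : ∀ a b, δ (a * b) = φ a * δ b + ψ b * δ a) {s : Set A}
    (hs : ∀ a, ∃ c : K, a - algebraMap K A c ∈ Ideal.span s) (hδs : ∀ a ∈ s, δ a = 0)
    {J : Ideal B} (hJ : ⨅ n : ℕ, J ^ n = ⊥) (hφ : ∀ a ∈ s, φ a ∈ J) : δ = 0 := by
  have h1 : δ 1 = 0 := by simpa using hδ 1 1
  -- Since δ kills constants and δ(xb) = φ(x)δ(b) for x ∈ `s`, each pass gains one power of `J`; no
  -- continuity of δ is needed.
  have hmem : ∀ (n : ℕ) (a : A), δ a ∈ J ^ n := by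
    intro n
    induction n with
    | zero => simp
    | succ n ih =>
      have hspan : ∀ z ∈ Ideal.span s, ∀ b, δ (z * b) ∈ J ^ (n + 1) := by
        intro z hz
        induction hz using Submodule.span_induction with
        | mem x hx =>
          intro b
          rw [hδ, hδs x hx, mul_zero, add_zero, pow_succ']
          exact Ideal.mul_mem_mul (hφ x hx) (ih b)
        | zero => simp
        | add x y _ _ hx hy =>
          intro b
          rw [add_mul, map_add]
          exact Ideal.add_mem _ (hx b) (hy b)
        | smul a x _ hx =>
          intro b
          rw [smul_eq_mul, mul_comm a, mul_assoc]
          exact hx _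
      intro a
      obtain ⟨c, hc⟩ := hs a
      have h2 := hspan _ hc 1
      rwa [mul_one, map_sub, Algebra.algebraMap_eq_smul_one, map_smul, h1, smul_zero,
        sub_zero] at h2
  ext a
  have : δ a ∈ ⨅ n : ℕ, J ^ n := (Submodule.mem_iInf _).2 fun n ↦ hmem n a
  rwa [hJ] at this

/-- The difference φ - ψ satisfies the twisted Leibniz rule. -/
theorem AlgHom.eq_of_eqOn_generators {K A B : Type*} [CommRing K] [CommRing A] [CommRing B]
    [Algebra K A] [Algebra K B] (φ ψ : A →ₐ[K] B) {s : Set A}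
    (hs : ∀ a, ∃ c : K, a - algebraMap K A c ∈ Ideal.span s) (h : ∀ a ∈ s, φ a = ψ a)
    {J : Ideal B} (hJ : ⨅ n : ℕ, J ^ n = ⊥) (hφ : ∀ a ∈ s, φ a ∈ J) : φ = ψ := by
  have h0 := LinearMap.eq_zero_of_twisted_leibniz (φ.toLinearMap - ψ.toLinearMap) φ ψ
    (fun a b ↦ by simp; ring) hs (fun a ha ↦ by simp [h a ha]) hJ hφ
  ext a
  exact sub_eq_zero.1 (LinearMap.congr_fun h0 a)

/-- A finite-dimensional algebra is integral over K, and a domain integral over a field is a field.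
-/
theorem isField_of_length_ne_top (K : Type*) {D : Type*} [Field K] [CommRing D] [IsDomain D]
    [Algebra K D] (h : Module.length K D ≠ ⊤) : IsField D := by
  rw [Module.length_ne_top_iff, isFiniteLength_iff_isNoetherian_isArtinian] at h
  obtain ⟨h1, -⟩ := h
  exact isField_of_isIntegral_of_isField' (R := K) (Field.toIsField K)

/-! ### The ring `K⟦X⟧⟦X⟧` with coordinates x = `C X`, y = `X`. -/

namespace PowerSeries

/-- Evaluation of a power series over a complete ring at a topologically nilpotent element. -/
theorem exists_algHom_ker_eq_span_X_sub_C (K : Type*) {A : Type*} [Field K]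
    [CommRing A] [Algebra K A] {I : Ideal A} [IsAdicComplete I A] {η : A} (hη : η ∈ I) :
    ∃ θ : A⟦X⟧ →ₐ[K] A, Function.Surjective θ ∧ θ X = η ∧ (∀ a, θ (C a) = a) ∧
      RingHom.ker θ = Ideal.span {X - C η} := by
  have hd : (Polynomial.X - Polynomial.C η).IsDistinguishedAt I := by
    rcases subsingleton_or_nontrivial A with hA | hA
    · exact ⟨⟨fun {n} _ ↦ by rw [Subsingleton.elim (Polynomial.coeff _ n) 0]; exact I.zero_mem⟩,
        Subsingleton.elim _ _⟩
    refine ⟨⟨fun {n} hn ↦ ?_⟩, Polynomial.monic_X_sub_C η⟩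
    rw [Polynomial.natDegree_X_sub_C, Nat.lt_one_iff] at hn
    simpa [hn] using hη
  -- Since X - η is distinguished, Weierstrass division identifies A⟦X⟧/(X - η) with A[X]/(X - η),
  -- which is A.
  let e := hd.algEquivQuotient.symm.trans (Polynomial.quotientSpanXSubCAlgEquiv η)
  have hcoe : ((Polynomial.X - Polynomial.C η : Polynomial A) : A⟦X⟧) = X - C η := by
    simp
  let θ : A⟦X⟧ →ₐ[A] A := e.toAlgHom.comp (Ideal.Quotient.mkₐ A _)
  have hker : RingHom.ker θ = Ideal.span {X - C η} := by
    ext f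
    rw [RingHom.mem_ker, ← hcoe, ← Ideal.Quotient.eq_zero_iff_mem]
    exact map_eq_zero_iff e e.injective
  refine ⟨θ.restrictScalars K, e.surjective.comp (Ideal.Quotient.mkₐ_surjective A _), ?_,
    θ.commutes, hker⟩
  have h : X - C η ∈ RingHom.ker θ := hker ▸ Ideal.mem_span_singleton_self _
  rw [RingHom.mem_ker, map_sub, sub_eq_zero] at h
  exact h.trans (θ.commutes η)

variable {K : Type*} [Field K]

theorem sub_algebraMap_mem_span_pair (f : K⟦X⟧⟦X⟧) :
    f - algebraMap K K⟦X⟧⟦X⟧ (constantCoeff (constantCoeff f)) ∈ Ideal.span {C X, X} := by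
  obtain ⟨g, hg⟩ : X ∣ f - C (constantCoeff f) := by rw [X_dvd_iff]; simp
  obtain ⟨h, hh⟩ : X ∣ constantCoeff f - C (constantCoeff (constantCoeff f)) := by
    rw [X_dvd_iff]; simp
  refine Ideal.mem_span_pair.2 ⟨C h, g, ?_⟩
  have hh' := congrArg (C (R := K⟦X⟧)) hh
  rw [map_sub, map_mul] at hh'
  rw [algebraMap_apply, algebraMap_apply, Algebra.algebraMap_self_apply]
  linear_combination -hh' - hg

theorem mem_maximalIdeal_iff₂ {f : K⟦X⟧⟦X⟧} :
    f ∈ IsLocalRing.maximalIdeal K⟦X⟧⟦X⟧ ↔ constantCoeff (constantCoeff f) = 0 := by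
  rw [IsLocalRing.mem_maximalIdeal, mem_nonunits_iff, isUnit_iff_constantCoeff,
    isUnit_iff_constantCoeff, isUnit_iff_ne_zero, not_not]

theorem not_X_dvd_C_X : ¬ (X : K⟦X⟧⟦X⟧) ∣ C X := by
  rw [X_dvd_iff, constantCoeff_C]
  exact X_ne_zero

/-- Otherwise (p) would be the maximal ideal, so p would divide both x and y; being associated to
the prime y, it cannot divide x. -/
theorem length_quotient_span_prime_eq_top {p : K⟦X⟧⟦X⟧} (hp : Prime p) :
    Module.length K (K⟦X⟧⟦X⟧ ⧸ Ideal.span {p}) = ⊤ := by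
  by_contra h
  have hprime : (Ideal.span {p}).IsPrime := (Ideal.span_singleton_prime hp.ne_zero).2 hp
  have hmax : (Ideal.span {p}).IsMaximal :=
    Ideal.Quotient.maximal_of_isField _ (isField_of_length_ne_top K h)
  have heq := IsLocalRing.eq_maximalIdeal hmax
  have hx : p ∣ X := by
    rw [← Ideal.mem_span_singleton, heq, mem_maximalIdeal_iff₂]; simp
  have hy : p ∣ C X := by
    rw [← Ideal.mem_span_singleton, heq, mem_maximalIdeal_iff₂]; simp
  exact not_X_dvd_C_X ((hp.associated_of_dvd X_prime hx).dvd'.trans hy)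

/-- The restriction of `f(x, y)` to the line `x = 0`. -/
noncomputable def restrictY : K⟦X⟧⟦X⟧ →ₐ[K] K⟦X⟧ :=
  mapAlgHom (⟨constantCoeff, fun r ↦ by simp⟩ : K⟦X⟧ →ₐ[K] K)

theorem coeff_restrictY (f : K⟦X⟧⟦X⟧) (n : ℕ) :
    coeff n (restrictY f) = constantCoeff (coeff n f) := rfl

@[simp] theorem restrictY_X : restrictY (X : K⟦X⟧⟦X⟧) = X := by
  ext n
  rw [coeff_restrictY, coeff_X, coeff_X]; split_ifs <;> simp

@[simp] theorem restrictY_C (f : K⟦X⟧) : restrictY (C f) = C (constantCoeff f) := by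
  ext n
  rw [coeff_restrictY, coeff_C, coeff_C]; split_ifs <;> simp

theorem restrictY_surjective : Function.Surjective (restrictY (K := K)) := fun f ↦
  ⟨map C f, by ext n; simp [coeff_restrictY]⟩

theorem restrictY_eq_zero_iff {f : K⟦X⟧⟦X⟧} : restrictY f = 0 ↔ C X ∣ f := by
  refine ⟨fun h ↦ ?_, ?_⟩
  · have : ∀ n, ∃ c, coeff n f = X * c := fun n ↦ by
      have := congrArg (coeff n) h
      rwa [coeff_restrictY, map_zero, ← X_dvd_iff] at this
    choose c hc using this
    exact ⟨mk c, by ext1 n; rw [coeff_C_mul, coeff_mk, hc]⟩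
  · rintro ⟨g, rfl⟩
    simp

theorem ker_restrictY : RingHom.ker (restrictY (K := K)) = Ideal.span {C X} := by
  ext f
  rw [RingHom.mem_ker, Ideal.mem_span_singleton]
  exact restrictY_eq_zero_iff

theorem prime_C_X : Prime (C X : K⟦X⟧⟦X⟧) := by
  rw [← Ideal.span_singleton_prime, ← ker_restrictY]
  · exact RingHom.ker_isPrime _
  · exact (map_ne_zero_iff _ C_injective).2 X_ne_zero

theorem quotLength_C_X_left (g : K⟦X⟧⟦X⟧) : quotLength K (C X) g = (restrictY g).order := by
  rw [quotLength_eq_of_surjective K restrictY_surjective ker_restrictY,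
    length_quotient_span_singleton]

end PowerSeries

/-! ### The substitution x ↦ x ^ e. -/

namespace PowerSeries

variable {K : Type*} [Field K]

/-- The component of a power series on the monomials of exponent `i` modulo `e`. -/
noncomputable def residueClassPart (e i : ℕ) : K⟦X⟧ →ₗ[K] K⟦X⟧ where
  toFun f := mk fun k ↦ coeff (e * k + i) f
  map_add' f g := by ext; simp
  map_smul' c f := by ext; simp

theorem coeff_residueClassPart (e i k : ℕ) (f : K⟦X⟧) :
    coeff k (residueClassPart e i f) = coeff (e * k + i) f := by
  simp [residueClassPart]

/-- `K⟦X⟧` is free over the image of `expand e` with basis 1, X, …, X^(e-1), and `residueClassPart e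
i` is the i-th coordinate; the next two lemmas complete this description. -/
theorem sum_X_pow_mul_expand_residueClassPart (e : ℕ) (he : e ≠ 0) (f : K⟦X⟧) :
    ∑ i : Fin e, X ^ (i : ℕ) * expand e he (residueClassPart e i f) = f := by
  ext n
  have hlt : n % e < e := Nat.mod_lt _ (Nat.pos_of_ne_zero he)
  rw [map_sum, Finset.sum_eq_single ⟨n % e, hlt⟩]
  · rw [coeff_X_pow_mul', if_pos (Nat.mod_le n e), coeff_expand, if_pos (Nat.dvd_sub_mod n),
      coeff_residueClassPart, Nat.mul_div_cancel' (Nat.dvd_sub_mod n),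
      Nat.sub_add_cancel (Nat.mod_le n e)]
  · intro i _ hi
    rw [coeff_X_pow_mul']
    split_ifs with h
    · rw [coeff_expand, if_neg]
      intro hd
      refine hi (Fin.ext ?_)
      have : (i : ℕ) % e = n % e := (Nat.modEq_iff_dvd' h).2 hd
      rwa [Nat.mod_eq_of_lt i.2] at this
    · rfl
  · simp

theorem residueClassPart_X_pow_mul_expand (e : ℕ) (he : e ≠ 0) (i j : Fin e) (f : K⟦X⟧) :
    residueClassPart e i (X ^ (j : ℕ) * expand e he f) = if i = j then f else 0 := by
  ext k
  rw [coeff_residueClassPart, coeff_X_pow_mul']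
  split_ifs with h h' h'
  · rw [coeff_expand, h', Nat.add_sub_cancel, if_pos (dvd_mul_right e k),
      Nat.mul_div_cancel_left _ (Nat.pos_of_ne_zero he)]
  · rw [coeff_expand, if_neg, map_zero]
    intro hd
    refine h' (Fin.ext ?_)
    have : (j : ℕ) % e = (e * k + i) % e := (Nat.modEq_iff_dvd' h).2 hd
    rw [Nat.mul_add_mod, Nat.mod_eq_of_lt i.2, Nat.mod_eq_of_lt j.2] at this
    exact this.symm
  · exact absurd (h' ▸ Nat.le_add_left _ _) h
  · simp

theorem residueClassPart_expand_mul (e : ℕ) (he : e ≠ 0) (i : Fin e) (f g : K⟦X⟧) :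
    residueClassPart e i (expand e he f * g) = f * residueClassPart e i g := by
  conv_lhs => rw [← sum_X_pow_mul_expand_residueClassPart e he g, Finset.mul_sum, map_sum]
  rw [Finset.sum_eq_single i]
  · rw [mul_left_comm, ← map_mul, residueClassPart_X_pow_mul_expand, if_pos rfl]
  · intro j _ hj
    rw [mul_left_comm, ← map_mul, residueClassPart_X_pow_mul_expand, if_neg hj.symm]
  · simp

/-- The substitution `f(x, y) ↦ f(x ^ e, y)`. -/
noncomputable def expandInner (e : ℕ) (he : e ≠ 0) : K⟦X⟧⟦X⟧ →ₐ[K] K⟦X⟧⟦X⟧ :=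
  mapAlgHom (expand e he)

theorem coeff_expandInner (e : ℕ) (he : e ≠ 0) (f : K⟦X⟧⟦X⟧) (n : ℕ) :
    coeff n (expandInner e he f) = expand e he (coeff n f) := rfl

theorem expandInner_eq_map (e : ℕ) (he : e ≠ 0) (f : K⟦X⟧⟦X⟧) :
    expandInner e he f = map (expand e he : K⟦X⟧ →ₐ[K] K⟦X⟧).toRingHom f := rfl

@[simp] theorem expandInner_X (e : ℕ) (he : e ≠ 0) :
    expandInner e he (X : K⟦X⟧⟦X⟧) = X := map_X _

@[simp] theorem expandInner_C (e : ℕ) (he : e ≠ 0) (f : K⟦X⟧) :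
    expandInner e he (C f) = C (expand e he f) := map_C _ _

noncomputable def residueClassPartInner (e i : ℕ) : K⟦X⟧⟦X⟧ →ₗ[K] K⟦X⟧⟦X⟧ where
  toFun f := mk fun n ↦ residueClassPart e i (coeff n f)
  map_add' f g := by ext1; simp
  map_smul' c f := by ext1; simp

theorem coeff_residueClassPartInner (e i n : ℕ) (f : K⟦X⟧⟦X⟧) :
    coeff n (residueClassPartInner e i f) = residueClassPart e i (coeff n f) := by
  simp [residueClassPartInner]

theorem sum_C_X_pow_mul_expandInner_residueClassPartInner (e : ℕ) (he : e ≠ 0) (f : K⟦X⟧⟦X⟧) :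
    ∑ i : Fin e, C (X ^ (i : ℕ)) * expandInner e he (residueClassPartInner e i f) = f := by
  ext1 n
  simp only [map_sum, coeff_C_mul, coeff_expandInner, coeff_residueClassPartInner]
  exact sum_X_pow_mul_expand_residueClassPart e he _

theorem residueClassPartInner_C_X_pow_mul_expandInner (e : ℕ) (he : e ≠ 0) (i j : Fin e)
    (f : K⟦X⟧⟦X⟧) :
    residueClassPartInner e i (C (X ^ (j : ℕ)) * expandInner e he f) = if i = j then f else 0 := by
  ext1 n
  rw [coeff_residueClassPartInner, coeff_C_mul, coeff_expandInner,
    residueClassPart_X_pow_mul_expand]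
  split_ifs <;> simp

theorem residueClassPartInner_expandInner_mul (e : ℕ) (he : e ≠ 0) (i : Fin e)
    (f g : K⟦X⟧⟦X⟧) :
    residueClassPartInner e i (expandInner e he f * g) = f * residueClassPartInner e i g := by
  ext1 n
  simp only [coeff_residueClassPartInner, coeff_mul, map_sum, coeff_expandInner,
    residueClassPart_expand_mul]

/-- Intersection numbers are multiplied by `e` under the substitution `x ↦ x ^ e`. -/
theorem quotLength_expandInner (e : ℕ) (he : e ≠ 0) (f g : K⟦X⟧⟦X⟧) :
    quotLength K (expandInner e he f) (expandInner e he g) = e * quotLength K f g := by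
  set I := Ideal.span ({f, g} : Set K⟦X⟧⟦X⟧) with hI
  set J := Ideal.span ({expandInner e he f, expandInner e he g} : Set K⟦X⟧⟦X⟧) with hJ
  -- Taking the `e` coordinates modulo `I` is surjective with kernel `J`, so the quotient by `J` is
  -- a sum of `e` copies of the quotient by `I`.
  let V : K⟦X⟧⟦X⟧ →ₗ[K] Fin e → K⟦X⟧⟦X⟧ ⧸ I := LinearMap.pi fun i ↦
    (Ideal.Quotient.mkₐ K I).toLinearMap ∘ₗ residueClassPartInner e i
  have hV : ∀ a i, V a i = Ideal.Quotient.mk I (residueClassPartInner e i a) := fun _ _ ↦ rfl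
  have hsurj : Function.Surjective V := by
    intro w
    choose a ha using fun i ↦ Ideal.Quotient.mk_surjective (w i)
    refine ⟨∑ j : Fin e, C (X ^ (j : ℕ)) * expandInner e he (a j), ?_⟩
    ext1 i
    rw [hV, map_sum]
    simp only [residueClassPartInner_C_X_pow_mul_expandInner]
    rw [Finset.sum_ite_eq, if_pos (Finset.mem_univ i), ha]
  have hmap : ∀ a ∈ I, expandInner e he a ∈ J := by
    intro a ha
    obtain ⟨b, c, rfl⟩ := Ideal.mem_span_pair.1 ha
    rw [map_add, map_mul, map_mul]
    exact Ideal.mem_span_pair.2 ⟨_, _, rfl⟩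
  have hker : J.restrictScalars K = LinearMap.ker V := by
    ext a
    rw [Submodule.restrictScalars_mem, LinearMap.mem_ker]
    constructor
    · intro ha
      obtain ⟨b, c, rfl⟩ := Ideal.mem_span_pair.1 ha
      ext1 i
      rw [hV, map_add, mul_comm b, mul_comm c, residueClassPartInner_expandInner_mul,
        residueClassPartInner_expandInner_mul, Pi.zero_apply, Ideal.Quotient.eq_zero_iff_mem]
      exact Ideal.mem_span_pair.2 ⟨residueClassPartInner e i b, residueClassPartInner e i c,
        by rw [mul_comm f, mul_comm g]⟩
    · intro ha
      rw [← sum_C_X_pow_mul_expandInner_residueClassPartInner e he a]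
      refine Ideal.sum_mem _ fun i _ ↦ Ideal.mul_mem_left _ _ (hmap _ ?_)
      rw [← Ideal.Quotient.eq_zero_iff_mem, ← hV, ha, Pi.zero_apply]
  have hlen := ((Submodule.Quotient.restrictScalarsEquiv K J).symm ≪≫ₗ
    Submodule.quotEquivOfEq _ _ hker ≪≫ₗ V.quotKerEquivOfSurjective hsurj).length_eq
  rw [quotLength, hlen, Module.length_pi_of_fintype]
  simp [quotLength]
  rfl

/-! ### Finiteness of intersection numbers and Puiseux factorization of power series. -/

/-- A substitute for the resultant: by Weierstrass preparation A⟦X⟧/(p) is a domain finite over A,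
and a nonzero ideal in an integral extension domain meets A nontrivially. -/
theorem exists_C_mem_span_pair {A : Type*} [CommRing A] [IsDomain A] [IsLocalRing A]
    [IsAdicComplete (IsLocalRing.maximalIdeal A) A] {p g : A⟦X⟧} (hp : Prime p)
    (hreg : p.map (IsLocalRing.residue A) ≠ 0) (hpg : ¬ p ∣ g) :
    ∃ a : A, a ≠ 0 ∧ C a ∈ Ideal.span {p, g} := by
  obtain ⟨h, u, H⟩ := exists_isWeierstrassFactorization hreg
  have hprime : (Ideal.span {p}).IsPrime := (Ideal.span_singleton_prime hp.ne_zero).2 hp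
  have hfin : Module.Finite A (Polynomial A ⧸ Ideal.span {h}) :=
    H.isDistinguishedAt.monic.finite_quotient
  have hfin' : Module.Finite A (A⟦X⟧ ⧸ Ideal.span {p}) :=
    Module.Finite.equiv H.algEquivQuotient.toLinearEquiv
  have hg : Ideal.Quotient.mk (Ideal.span {p}) g ≠ 0 := by
    rwa [ne_eq, Ideal.Quotient.eq_zero_iff_mem, Ideal.mem_span_singleton]
  have hne := Ideal.comap_ne_bot_of_integral_mem (R := A) hg
    (Ideal.mem_span_singleton_self _) (Algebra.IsIntegral.isIntegral _)
  obtain ⟨a, ha, ha0⟩ := Submodule.exists_mem_ne_zero_of_ne_bot hne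
  refine ⟨a, ha0, ?_⟩
  obtain ⟨b, hb⟩ := Ideal.mem_span_singleton'.1 (Ideal.mem_comap.1 ha)
  obtain ⟨b, rfl⟩ := Ideal.Quotient.mk_surjective b
  have hb' : Ideal.Quotient.mk (Ideal.span {p}) (b * g) = Ideal.Quotient.mk _ (C a) := by
    rw [map_mul, hb]; rfl
  rw [Ideal.Quotient.mk_eq_mk_iff_sub_mem, Ideal.mem_span_singleton'] at hb'
  obtain ⟨c, hc⟩ := hb'
  exact Ideal.mem_span_pair.2 ⟨-c, b, by linear_combination -hc⟩

theorem map_residue_ne_zero_iff {f : K⟦X⟧⟦X⟧} :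
    f.map (IsLocalRing.residue K⟦X⟧) ≠ 0 ↔ restrictY f ≠ 0 := by
  refine not_congr ⟨fun h ↦ ?_, fun h ↦ ?_⟩ <;> ext n
  · have := congrArg (coeff n) h
    rwa [coeff_map, map_zero, IsLocalRing.residue_eq_zero_iff,
      mem_maximalIdeal_iff_constantCoeff_eq_zero] at this
  · have := congrArg (coeff n) h
    rwa [coeff_map, map_zero, IsLocalRing.residue_eq_zero_iff,
      mem_maximalIdeal_iff_constantCoeff_eq_zero]

/-- The ideal (p, g) contains a nonzero series in x, hence some x^n, and i(p, x^n) = n · ord p(0, y)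
is finite. -/
theorem quotLength_ne_top_of_not_dvd {p g : K⟦X⟧⟦X⟧} (hp : Prime p) (hreg : restrictY p ≠ 0)
    (hpg : ¬ p ∣ g) : quotLength K p g ≠ ⊤ := by
  obtain ⟨a, ha, hmem⟩ := exists_C_mem_span_pair hp (map_residue_ne_zero_iff.2 hreg) hpg
  set n := a.order.toNat
  have hau : X ^ n * (Unit_of_divided_by_X_pow_order a : K⟦X⟧) = a := by
    rw [Unit_of_divided_by_X_pow_order_nonzero ha, X_pow_order_mul_divXPowOrder]
  have hle : quotLength K p g ≤ quotLength K p (C X ^ n) := by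
    refine quotLength_le_of_mem K (Ideal.mem_span_pair.2 ⟨1, 0, by ring⟩) ?_
    have : (C X ^ n : K⟦X⟧⟦X⟧) =
        C (↑(Unit_of_divided_by_X_pow_order a)⁻¹ : K⟦X⟧) * C a := by
      rw [← map_mul, ← map_pow]
      exact congrArg C ((Units.eq_inv_mul_iff_mul_eq _).2 (by rw [mul_comm]; exact hau))
    rw [this]
    exact Ideal.mul_mem_left _ _ hmem
  refine ne_top_of_le_ne_top ?_ hle
  have h := quotLength_multiset_prod_left K (Multiset.replicate n ()) (fun _ ↦ (C X : K⟦X⟧⟦X⟧))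
    (fun _ _ ↦ prime_C_X) (fun _ _ ↦ length_quotient_span_prime_eq_top prime_C_X) p
  rw [Multiset.map_replicate, Multiset.prod_replicate, Multiset.map_replicate,
    Multiset.sum_replicate, quotLength_C_X_left] at h
  have hord : (restrictY p).order ≠ ⊤ := by simpa using hreg
  rw [quotLength_comm, h, nsmul_eq_mul]
  lift (restrictY p).order to ℕ using hord with d
  exact_mod_cast ENat.natCast_ne_top (n * d)

variable [IsAlgClosed K] [CharZero K]

/-- **Puiseux's theorem**: a power series not vanishing on the line `x = 0` is a product of
smooth branches after the substitution `x ↦ x ^ e`. -/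
theorem exists_expandInner_eq_prod {f : K⟦X⟧⟦X⟧} (hf : restrictY f ≠ 0) :
    ∃ (e : ℕ) (he : e ≠ 0) (m : Multiset K⟦X⟧) (u : K⟦X⟧⟦X⟧),
      (∀ η ∈ m, constantCoeff η = 0) ∧ IsUnit u ∧
      expandInner e he f = (m.map fun η ↦ X - C η).prod * u := by
  obtain ⟨h, u, H⟩ := exists_isWeierstrassFactorization (map_residue_ne_zero_iff.2 hf)
  obtain ⟨e, he, hs⟩ := H.isDistinguishedAt.monic.exists_splits_map_expand
  set φ := (expand e he : K⟦X⟧ →ₐ[K] K⟦X⟧).toRingHom with hφ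
  have hm := H.isDistinguishedAt.monic.map φ
  refine ⟨e, he, (h.map φ).roots, expandInner e he u, fun η hη ↦ ?_,
    H.isUnit.map _, ?_⟩
  · have hroot := congrArg (constantCoeff (R := K)) ((Polynomial.mem_roots hm.ne_zero).1 hη)
    have hcc : (constantCoeff (R := K)).comp φ = constantCoeff :=
      RingHom.ext fun a ↦ constantCoeff_expand e he a
    have hX : h.map (constantCoeff (R := K)) = Polynomial.X ^ h.natDegree := by
      ext i
      rw [Polynomial.coeff_map, Polynomial.coeff_X_pow]
      split_ifs with hi
      · rw [hi, H.isDistinguishedAt.monic.coeff_natDegree, map_one]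
      · rcases lt_or_gt_of_ne hi with hi | hi
        · exact mem_maximalIdeal_iff_constantCoeff_eq_zero.1 (H.isDistinguishedAt.mem hi)
        · rw [Polynomial.coeff_eq_zero_of_natDegree_lt hi, map_zero]
    rw [map_zero, ← Polynomial.eval_map_apply, Polynomial.map_map, hcc, hX,
      Polynomial.eval_pow, Polynomial.eval_X] at hroot
    exact eq_zero_of_pow_eq_zero hroot
  · have hprod := congrArg (Polynomial.coeToPowerSeries.ringHom (R := K⟦X⟧))
      (hs.eq_prod_roots_of_monic hm)
    rw [map_multiset_prod, Multiset.map_map] at hprod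
    rw [H.eq_mul, map_mul, expandInner_eq_map e he (h : K⟦X⟧⟦X⟧), ← hφ,
      ← Polynomial.polynomial_map_coe]
    congr 1
    refine hprod.trans ?_
    congr 1
    refine Multiset.map_congr rfl fun η _ ↦ ?_
    simp

end PowerSeries

theorem ENat.eq_of_natCast_mul_eq {n : ℕ} (hn : n ≠ 0) {a b : ℕ∞} (h : n * a = n * b) :
    a = b := by
  have hn' : (n : ℕ∞) ≠ 0 := by exact_mod_cast hn
  rcases eq_or_ne a ⊤ with rfl | ha <;> rcases eq_or_ne b ⊤ with rfl | hb
  · rfl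
  · lift b to ℕ using hb
    rw [ENat.mul_top hn'] at h
    exact absurd h.symm (by exact_mod_cast ENat.natCast_ne_top (n * b))
  · lift a to ℕ using ha
    rw [ENat.mul_top hn'] at h
    exact absurd h (by exact_mod_cast ENat.natCast_ne_top (n * a))
  · lift a to ℕ using ha
    lift b to ℕ using hb
    norm_cast at h ⊢
    exact Nat.eq_of_mul_eq_mul_left (Nat.pos_of_ne_zero hn) h

/-! ### Formal arcs, parametrizations and Teissier's lemma. -/

namespace PowerSeries

variable {K : Type*} [Field K]

theorem iInf_maximalIdeal_pow_eq_bot {R : Type*} [CommRing R] [IsNoetherianRing R]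
    [IsLocalRing R] : ⨅ n : ℕ, IsLocalRing.maximalIdeal R ^ n = ⊥ :=
  Ideal.iInf_pow_eq_bot_of_isLocalRing _ Ideal.IsPrime.ne_top'

/-- The chain rule along a formal arc. -/
theorem derivative_algHom_apply (dx dy : Derivation K K⟦X⟧⟦X⟧ K⟦X⟧⟦X⟧)
    (hxx : dx (C X) = 1) (hxy : dx X = 0) (hyx : dy (C X) = 0) (hyy : dy X = 1)
    (γ : K⟦X⟧⟦X⟧ →ₐ[K] K⟦X⟧) (hx : constantCoeff (γ (C X)) = 0)
    (hy : constantCoeff (γ X) = 0) (f : K⟦X⟧⟦X⟧) :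
    derivative K (γ f) =
      γ (dx f) * derivative K (γ (C X)) + γ (dy f) * derivative K (γ X) := by
  let δ : K⟦X⟧⟦X⟧ →ₗ[K] K⟦X⟧ := (derivative K).toLinearMap ∘ₗ γ.toLinearMap -
    (LinearMap.mulRight K (derivative K (γ (C X))) ∘ₗ γ.toLinearMap ∘ₗ dx.toLinearMap +
      LinearMap.mulRight K (derivative K (γ X)) ∘ₗ γ.toLinearMap ∘ₗ dy.toLinearMap)
  have hδ : ∀ a, δ a = derivative K (γ a) -
      (γ (dx a) * derivative K (γ (C X)) + γ (dy a) * derivative K (γ X)) := fun _ ↦ rfl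
  have h0 : δ = 0 := LinearMap.eq_zero_of_twisted_leibniz δ γ γ
    (fun a b ↦ by
      simp only [hδ, map_mul, Derivation.leibniz, smul_eq_mul, map_add]; ring)
    (fun a ↦ ⟨_, sub_algebraMap_mem_span_pair a⟩)
    (by
      rintro a (rfl | rfl)
      · simp [hδ, hxx, hyx]
      · simp [hδ, hxy, hyy])
    iInf_maximalIdeal_pow_eq_bot
    (by
      rintro a (rfl | rfl)
      · exact mem_maximalIdeal_iff_constantCoeff_eq_zero.2 hx
      · exact mem_maximalIdeal_iff_constantCoeff_eq_zero.2 hy)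
  exact sub_eq_zero.1 ((hδ f).symm.trans (LinearMap.congr_fun h0 f))

theorem constantCoeff_algHom_apply_eq_zero (γ : K⟦X⟧⟦X⟧ →ₐ[K] K⟦X⟧)
    (hx : constantCoeff (γ (C X)) = 0) (hy : constantCoeff (γ X) = 0) {f : K⟦X⟧⟦X⟧}
    (hf : constantCoeff (constantCoeff f) = 0) : constantCoeff (γ f) = 0 := by
  have h := sub_algebraMap_mem_span_pair f
  rw [hf, map_zero, sub_zero] at h
  obtain ⟨a, b, rfl⟩ := Ideal.mem_span_pair.1 h
  simp [hx, hy]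

/-- The operator X · d/dX multiplies the n-th coefficient by n, so it can only lose the constant
term. -/
theorem order_X_mul_derivative [CharZero K] {w : K⟦X⟧} (hw : constantCoeff w = 0) :
    (X * derivative K w).order = w.order := by
  have h : ∀ n, coeff n (X * derivative K w) = n * coeff n w := by
    intro n
    rcases n with _ | n
    · simp
    · rw [coeff_succ_X_mul, coeff_derivative, mul_comm]; push_cast; ring
  refine le_antisymm ?_ ?_
  · refine le_order _ _ fun i hi ↦ ?_
    have h1 := coeff_of_lt_order i hi
    rw [h] at h1
    rcases i with _ | i
    · rwa [coeff_zero_eq_constantCoeff_apply]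
    · exact (mul_eq_zero.1 h1).resolve_left (by exact_mod_cast i.succ_ne_zero)
  · refine le_order _ _ fun i hi ↦ ?_
    rw [h, coeff_of_lt_order i hi, mul_zero]

/-- Evaluation `f(x, y) ↦ f(x, η(x))` at a series `η` without constant term. -/
noncomputable def evalInner (η : K⟦X⟧) (hη : constantCoeff η = 0) : K⟦X⟧⟦X⟧ →ₐ[K] K⟦X⟧ :=
  (exists_algHom_ker_eq_span_X_sub_C K
    (mem_maximalIdeal_iff_constantCoeff_eq_zero.2 hη)).choose

section

variable {η : K⟦X⟧} (hη : constantCoeff η = 0)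

theorem evalInner_surjective : Function.Surjective (evalInner η hη) :=
  (exists_algHom_ker_eq_span_X_sub_C K
    (mem_maximalIdeal_iff_constantCoeff_eq_zero.2 hη)).choose_spec.1

theorem evalInner_X : evalInner η hη X = η :=
  (exists_algHom_ker_eq_span_X_sub_C K
    (mem_maximalIdeal_iff_constantCoeff_eq_zero.2 hη)).choose_spec.2.1

theorem evalInner_C (a : K⟦X⟧) : evalInner η hη (C a) = a :=
  (exists_algHom_ker_eq_span_X_sub_C K
    (mem_maximalIdeal_iff_constantCoeff_eq_zero.2 hη)).choose_spec.2.2.1 a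

theorem ker_evalInner : RingHom.ker (evalInner η hη) = Ideal.span {X - C η} :=
  (exists_algHom_ker_eq_span_X_sub_C K
    (mem_maximalIdeal_iff_constantCoeff_eq_zero.2 hη)).choose_spec.2.2.2

include hη in
theorem prime_X_sub_C : Prime (X - C η : K⟦X⟧⟦X⟧) := by
  rw [← Ideal.span_singleton_prime, ← ker_evalInner hη]
  · exact RingHom.ker_isPrime _
  · intro h
    have := congrArg (coeff 1) h
    simp at this

theorem quotLength_X_sub_C_left (g : K⟦X⟧⟦X⟧) :
    quotLength K (X - C η) g = (evalInner η hη g).order := by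
  rw [quotLength_eq_of_surjective K (evalInner_surjective hη) (ker_evalInner hη),
    length_quotient_span_singleton]

end

/-- Intersection numbers are computed by parametrizations of the branches of one of the curves. -/
theorem exists_parametrization [IsAlgClosed K] [CharZero K] {f : K⟦X⟧⟦X⟧}
    (hreg : restrictY f ≠ 0) :
    ∃ (e : ℕ) (m : Multiset (K⟦X⟧⟦X⟧ →ₐ[K] K⟦X⟧)), e ≠ 0 ∧
      (∀ γ ∈ m, γ (C X) = X ^ e ∧ constantCoeff (γ X) = 0 ∧ γ f = 0) ∧
      ∀ g, e * quotLength K f g = (m.map fun γ ↦ (γ g).order).sum := by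
  obtain ⟨e, he, m, u, hm, hu, heq⟩ := exists_expandInner_eq_prod hreg
  -- Each Puiseux root η gives the arc t ↦ (t^e, η(t)).
  refine ⟨e, m.pmap (fun η hη ↦ (evalInner η hη).comp (expandInner e he)) hm, he, ?_, ?_⟩
  · intro γ hγ
    obtain ⟨η, hη, rfl⟩ := Multiset.mem_pmap.1 hγ
    have hη0 := hm η hη
    refine ⟨?_, ?_, ?_⟩
    · rw [AlgHom.comp_apply, expandInner_C, expand_X, evalInner_C]
    · rw [AlgHom.comp_apply, expandInner_X, evalInner_X, hη0]
    · rw [AlgHom.comp_apply, heq, ← RingHom.mem_ker, ker_evalInner]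
      exact Ideal.mul_mem_right _ _ (Ideal.mem_span_singleton.2
        (Multiset.dvd_prod (Multiset.mem_map_of_mem _ hη)))
  · intro g
    rw [← quotLength_expandInner e he, heq, quotLength_mul_isUnit_left K hu,
      quotLength_multiset_prod_left K m _ (fun η hη ↦ prime_X_sub_C (hm η hη))
        (fun η hη ↦ length_quotient_span_prime_eq_top (prime_X_sub_C (hm η hη))),
      Multiset.map_pmap, ← Multiset.pmap_eq_map _ _ m hm]
    exact congrArg _ (Multiset.pmap_congr m fun η _ hη _ ↦ quotLength_X_sub_C_left hη _)

section Regular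

variable (dx dy : Derivation K K⟦X⟧⟦X⟧ K⟦X⟧⟦X⟧)
    (hxx : dx (C X) = 1) (hxy : dx X = 0) (hyx : dy (C X) = 0) (hyy : dy X = 1)
    {f : K⟦X⟧⟦X⟧} (hf : constantCoeff (constantCoeff f) = 0)

include hxx hxy hyx hyy

theorem restrictY_derivation (f : K⟦X⟧⟦X⟧) :
    restrictY (dy f) = derivative K (restrictY f) := by
  rw [derivative_algHom_apply dx dy hxx hxy hyx hyy restrictY (by simp) (by simp)]
  simp

include hf

variable [CharZero K]

theorem order_restrictY_derivation_add_one :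
    (restrictY (dy f)).order + 1 = (restrictY f).order := by
  rw [restrictY_derivation dx dy hxx hxy hyx hyy, ← order_X_mul_derivative
    (constantCoeff_algHom_apply_eq_zero restrictY (by simp) (by simp) hf), order_mul, order_X,
    add_comm]

/-- Where f_y vanishes, the chain rule reads t · d/dt γ(f) = e · γ(x f_x), and t · d/dt preserves
the order. -/
theorem order_algHom_eq (γ : K⟦X⟧⟦X⟧ →ₐ[K] K⟦X⟧) {e : ℕ} (he : e ≠ 0) (hγx : γ (C X) = X ^ e)
    (hγy : constantCoeff (γ X) = 0) (hγ : γ (dy f) = 0) :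
    (γ f).order = (γ (C X * dx f)).order := by
  have he' : (e : K) ≠ 0 := by exact_mod_cast he
  have hγx0 : constantCoeff (γ (C X)) = 0 := by rw [hγx]; simp [he]
  have hch := derivative_algHom_apply dx dy hxx hxy hyx hyy γ hγx0 hγy f
  rw [hγ, zero_mul, add_zero, hγx, derivative_pow, derivative_X, mul_one] at hch
  have h1 : X * derivative K (γ f) = C (e : K) * γ (C X * dx f) := by
    rw [hch, map_mul γ, hγx, map_natCast]
    obtain ⟨k, rfl⟩ := Nat.exists_eq_succ_of_ne_zero he
    rw [Nat.succ_sub_one, pow_succ]; ring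
  rw [← order_X_mul_derivative (constantCoeff_algHom_apply_eq_zero γ hγx0 hγy hf), h1, order_mul,
    order_zero_of_unit ((isUnit_iff_ne_zero.2 he').map C), zero_add]

/-- If `∂f/∂y` is nonzero on `x = 0`, then `f` and `x ∂f/∂x` have the same intersection number
with the polar curve `∂f/∂y = 0`. -/
theorem quotLength_derivation_eq [IsAlgClosed K] (hreg : restrictY (dy f) ≠ 0) :
    quotLength K (dy f) f = quotLength K (dy f) (C X * dx f) := by
  obtain ⟨e, m, he, hm, hlen⟩ := exists_parametrization hreg
  have h : (e : ℕ∞) * quotLength K (dy f) f = e * quotLength K (dy f) (C X * dx f) := by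
    rw [hlen, hlen]
    refine congrArg _ (Multiset.map_congr rfl fun γ hγ ↦ ?_)
    obtain ⟨h1, h2, h3⟩ := hm γ hγ
    exact order_algHom_eq dx dy hxx hxy hyx hyy hf γ he h1 h2 h3
  exact ENat.eq_of_natCast_mul_eq he h

/-- Teissier's lemma: `i(f, ∂f/∂y) + 1 = μ(f) + i(f, x)`. -/
theorem quotLength_derivation_add_one [IsAlgClosed K] (hreg : restrictY f ≠ 0) :
    quotLength K f (dy f) + 1 = quotLength K (dx f) (dy f) + (restrictY f).order := by
  have hreg' : restrictY (dy f) ≠ 0 := by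
    intro h
    have := order_restrictY_derivation_add_one dx dy hxx hxy hyx hyy hf
    rw [h, order_zero, top_add] at this
    exact hreg (order_eq_top.1 this.symm)
  -- Split off the factor x: i(x, f_y) is the order of f_y(0, y), one less than that of f(0, y).
  rw [quotLength_comm, quotLength_derivation_eq dx dy hxx hxy hyx hyy hf hreg', quotLength_comm,
    quotLength_prime_mul_left K prime_C_X (length_quotient_span_prime_eq_top prime_C_X),
    quotLength_C_X_left, add_right_comm, order_restrictY_derivation_add_one dx dy hxx hxy hyx hyy hf,
    add_comm]

end Regular

end PowerSeries

/-! ### Milnor numbers of products. -/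

/-- The last factor is arbitrary, because it will be a derivative ∂_y F_i. -/
theorem quotLength_finset_prod_mul_left (K : Type*) {S : Type*} [Field K] [CommRing S]
    [Algebra K S] [IsDomain S] {ι : Type*} (s : Finset ι) (p : ι → S)
    (hp : ∀ i ∈ s, Prime (p i))
    (htop : ∀ i ∈ s, Module.length K (S ⧸ Ideal.span {p i}) = ⊤) (f g : S) :
    quotLength K ((∏ i ∈ s, p i) * f) g = ∑ i ∈ s, quotLength K (p i) g + quotLength K f g := by
  classical
  induction s using Finset.induction_on with
  | empty => simp
  | insert i s hi ih =>
    rw [Finset.prod_insert hi, Finset.sum_insert hi, mul_assoc,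
      quotLength_prime_mul_left K (hp i (by simp)) (htop i (by simp)),
      ih (fun j hj ↦ hp j (by simp [hj])) (fun j hj ↦ htop j (by simp [hj])), add_assoc]

theorem sum_sum_erase_eq_two_mul_sum_sum_Ioi {n : ℕ} {c : Fin n → Fin n → ℕ}
    (hc : ∀ i j, c i j = c j i) :
    ∑ i, ∑ j ∈ Finset.univ.erase i, c i j = 2 * ∑ i, ∑ j ∈ Finset.Ioi i, c i j := by
  have h1 : ∀ i, ∑ j ∈ Finset.univ.erase i, c i j =
      ∑ j ∈ Finset.Ioi i, c i j + ∑ j ∈ Finset.Iio i, c i j := by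
    intro i
    rw [← Finset.sum_union (Finset.disjoint_left.2 fun j hj hj' ↦
      lt_asymm (Finset.mem_Ioi.1 hj) (Finset.mem_Iio.1 hj'))]
    refine Finset.sum_congr (Finset.ext fun j ↦ ?_) fun _ _ ↦ rfl
    simp only [Finset.mem_erase, Finset.mem_univ, and_true, Finset.mem_union, Finset.mem_Ioi,
      Finset.mem_Iio]
    exact ne_iff_lt_or_gt.trans or_comm
  have h2 : ∑ i, ∑ j ∈ Finset.Iio i, c i j = ∑ i, ∑ j ∈ Finset.Ioi i, c i j := by
    rw [Finset.sum_comm' (t' := Finset.univ) (s' := fun j ↦ Finset.Ioi j) (by simp)]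
    exact Finset.sum_congr rfl fun i _ ↦ Finset.sum_congr rfl fun j _ ↦ hc j i
  rw [Finset.sum_congr rfl fun i _ ↦ h1 i, Finset.sum_add_distrib, h2, two_mul]

namespace PowerSeries

variable {K : Type*} [Field K]

/-- Modulo F_i only one term of the Leibniz rule survives, (∂F_i) ∏_{j≠i} F_j. -/
theorem quotLength_derivation_prod (dy : Derivation K K⟦X⟧⟦X⟧ K⟦X⟧⟦X⟧)
    {ι : Type*} [Fintype ι] [DecidableEq ι] (F : ι → K⟦X⟧⟦X⟧) (hF : ∀ i, Prime (F i)) :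
    quotLength K (∏ i, F i) (dy (∏ i, F i)) =
      ∑ i, (∑ j ∈ Finset.univ.erase i, quotLength K (F i) (F j) +
        quotLength K (F i) (dy (F i))) := by
  have htop := fun i ↦ length_quotient_span_prime_eq_top (hF i)
  rw [quotLength_finset_prod_left K _ F (fun i _ ↦ hF i) fun i _ ↦ htop i]
  refine Finset.sum_congr rfl fun i _ ↦ ?_
  rw [← Finset.mul_prod_erase Finset.univ F (Finset.mem_univ i), Derivation.leibniz, smul_eq_mul,
    smul_eq_mul, add_comm, quotLength_add_mul_right, quotLength_comm,
    quotLength_finset_prod_mul_left K _ F (fun i _ ↦ hF i) fun i _ ↦ htop i,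
    quotLength_comm K (dy (F i))]
  congr 1
  exact Finset.sum_congr rfl fun j _ ↦ quotLength_comm K _ _

variable [CharZero K] (dx dy : Derivation K K⟦X⟧⟦X⟧ K⟦X⟧⟦X⟧)
  (hxx : dx (C X) = 1) (hxy : dx X = 0) (hyx : dy (C X) = 0) (hyy : dy X = 1)

include hxx hxy hyx hyy

/-- On x = 0 the derivative has finite order one less than f, so it is not a multiple of f. -/
theorem not_dvd_derivation {f : K⟦X⟧⟦X⟧} (hf : constantCoeff (constantCoeff f) = 0)
    (hreg : restrictY f ≠ 0) : ¬ f ∣ dy f := by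
  rintro ⟨g, hg⟩
  have h := order_restrictY_derivation_add_one dx dy hxx hxy hyx hyy hf
  have hfin : (restrictY f).order ≠ ⊤ := by simpa using hreg
  rw [hg, map_mul, order_mul] at h
  have hle : (restrictY f).order + 1 ≤ (restrictY f).order := by
    conv_rhs => rw [← h, add_right_comm]
    exact le_self_add
  lift (restrictY f).order to ℕ using hfin with d
  norm_cast at hle
  omega

/-- The Milnor number of a reduced curve in terms of its irreducible components, in coordinates
for which no component is the line `x = 0`. -/
theorem quotLength_derivation_prod_add [IsAlgClosed K] {n : ℕ} (hn : n ≠ 0) (F : Fin n → K⟦X⟧⟦X⟧)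
    (hF : ∀ i, Prime (F i)) (hdvd : ∀ i j, i ≠ j → ¬ F i ∣ F j)
    (hreg : restrictY (∏ i, F i) ≠ 0) :
    quotLength K (dx (∏ i, F i)) (dy (∏ i, F i)) ≠ ⊤ ∧
      quotLength K (dx (∏ i, F i)) (dy (∏ i, F i)) + ((n - 1 : ℕ) : ℕ∞) =
        ∑ i, quotLength K (dx (F i)) (dy (F i)) +
          2 * ∑ i, ∑ j ∈ Finset.Ioi i, quotLength K (F i) (F j) := by
  have hreg_i : ∀ i, restrictY (F i) ≠ 0 := by
    intro i h
    rw [map_prod] at hreg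
    exact hreg (Finset.prod_eq_zero (Finset.mem_univ i) h)
  have hcc : ∀ i, constantCoeff (constantCoeff (F i)) = 0 := fun i ↦
    mem_maximalIdeal_iff₂.1 ((IsLocalRing.mem_maximalIdeal _).2 (hF i).not_isUnit)
  have hccf : constantCoeff (constantCoeff (∏ i, F i)) = 0 := by
    rw [map_prod, map_prod]
    exact Finset.prod_eq_zero (Finset.mem_univ ⟨0, Nat.pos_of_ne_zero hn⟩) (hcc _)
  have ho : ∀ i, (restrictY (F i)).order ≠ ⊤ := fun i ↦ by simpa using hreg_i i
  have hc : ∀ i j, i ≠ j → quotLength K (F i) (F j) ≠ ⊤ := fun i j hij ↦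
    quotLength_ne_top_of_not_dvd (hF i) (hreg_i i) (hdvd i j hij)
  have ha : ∀ i, quotLength K (F i) (dy (F i)) ≠ ⊤ := fun i ↦
    quotLength_ne_top_of_not_dvd (hF i) (hreg_i i)
      (not_dvd_derivation dx dy hxx hxy hyx hyy (hcc i) (hreg_i i))
  have hT := fun i ↦ quotLength_derivation_add_one dx dy hxx hxy hyx hyy (hcc i) (hreg_i i)
  have hTf := quotLength_derivation_add_one dx dy hxx hxy hyx hyy hccf hreg
  have hord : (restrictY (∏ i, F i)).order = ∑ i, (restrictY (F i)).order := by
    rw [map_prod, order_prod]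
  rw [quotLength_derivation_prod dy F hF, hord] at hTf
  choose o ho' using fun i ↦ ENat.ne_top_iff_exists.1 (ho i)
  choose a ha' using fun i ↦ ENat.ne_top_iff_exists.1 (ha i)
  -- The diagonal intersection numbers are infinite; `toNat` assigns them a junk value that no sum
  -- below uses.
  obtain ⟨c, hcs, hc'⟩ : ∃ c : Fin n → Fin n → ℕ, (∀ i j, c i j = c j i) ∧
      ∀ i j, i ≠ j → quotLength K (F i) (F j) = c i j := by
    refine ⟨fun i j ↦ (quotLength K (F i) (F j)).toNat,
      fun i j ↦ congrArg _ (quotLength_comm K _ _),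
      fun i j hij ↦ (ENat.natCast_toNat (hc i j hij)).symm⟩
  have hM : ∀ i, quotLength K (dx (F i)) (dy (F i)) ≠ ⊤ := by
    intro i h
    have := hT i
    rw [h, top_add, ← ha'] at this
    exact absurd this (by exact_mod_cast ENat.natCast_ne_top (a i + 1))
  choose M hM' using fun i ↦ ENat.ne_top_iff_exists.1 (hM i)
  simp only [← hM', ← ho', ← ha'] at hT hTf ⊢
  have hsum1 : ∑ i, ((∑ j ∈ Finset.univ.erase i, quotLength K (F i) (F j)) + (a i : ℕ∞)) =
      ((∑ i, (∑ j ∈ Finset.univ.erase i, c i j + a i) : ℕ) : ℕ∞) := by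
    push_cast
    refine Finset.sum_congr rfl fun i _ ↦ ?_
    congr 1
    exact Finset.sum_congr rfl fun j hj ↦ hc' i j (Finset.ne_of_mem_erase hj).symm
  have hsum2 : ∑ i, ∑ j ∈ Finset.Ioi i, quotLength K (F i) (F j) =
      ((∑ i, ∑ j ∈ Finset.Ioi i, c i j : ℕ) : ℕ∞) := by
    push_cast
    exact Finset.sum_congr rfl fun i _ ↦ Finset.sum_congr rfl fun j hj ↦
      hc' i j (Finset.mem_Ioi.1 hj).ne
  rw [hsum1] at hTf
  rw [hsum2]
  have hne : quotLength K (dx (∏ i, F i)) (dy (∏ i, F i)) ≠ ⊤ := by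
    intro h
    rw [h, top_add] at hTf
    exact absurd hTf (by
      exact_mod_cast ENat.natCast_ne_top (∑ i, (∑ j ∈ Finset.univ.erase i, c i j + a i) + 1))
  refine ⟨hne, ?_⟩
  lift quotLength K (dx (∏ i, F i)) (dy (∏ i, F i)) to ℕ using hne with m
  norm_cast at hT hTf ⊢
  -- The `n` identities for the components contribute n to the left side, against 1 for the product;
  -- the difference is n - 1.
  have hsum := Finset.sum_congr (rfl : (Finset.univ : Finset (Fin n)) = _) fun i _ ↦ hT i
  rw [Finset.sum_add_distrib, Finset.sum_add_distrib, Finset.sum_const, Finset.card_univ,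
    Fintype.card_fin, smul_eq_mul, mul_one] at hsum
  rw [Finset.sum_add_distrib, sum_sum_erase_eq_two_mul_sum_sum_Ioi hcs] at hTf
  omega

end PowerSeries

/-! ### Transport to coordinates in general position. -/

/-- The derivation conjugate to `D` under an isomorphism of algebras. -/
noncomputable def Derivation.conj {K A B : Type*} [CommRing K] [CommRing A] [CommRing B]
    [Algebra K A] [Algebra K B] (e : A ≃ₐ[K] B) (D : Derivation K A A) : Derivation K B B :=
  Derivation.mk' (e.toLinearMap ∘ₗ D.toLinearMap ∘ₗ e.symm.toLinearMap) fun a b ↦ by simp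

theorem Derivation.conj_apply {K A B : Type*} [CommRing K] [CommRing A] [CommRing B]
    [Algebra K A] [Algebra K B] (e : A ≃ₐ[K] B) (D : Derivation K A A) (a : A) :
    D.conj e (e a) = e (D a) := by
  change e (D (e.symm (e a))) = _
  rw [e.symm_apply_apply]

namespace PlaneSeries

open PowerSeries

/-- Power series in `X 0` over the ring of power series in `X 1`. -/
noncomputable def iteratedEquiv : PlaneSeries ≃ₐ[ℂ] ℂ⟦X⟧⟦X⟧ :=
  (MvPowerSeries.renameEquiv ℂ ((finSuccEquiv 1).trans
    (Equiv.optionCongr (Equiv.ofUnique (Fin 1) Unit)))).trans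
    (MvPowerSeries.optionEquivLeft Unit ℂ)

/-- The outer variable, called y in `K⟦X⟧⟦X⟧`, is `X 0`: the names x and y are exchanged with
respect to `PlaneSeries`. -/
theorem iteratedEquiv_X_zero : iteratedEquiv (MvPowerSeries.X 0) = X := by
  rw [iteratedEquiv, AlgEquiv.trans_apply]
  change MvPowerSeries.optionEquivLeft Unit ℂ (MvPowerSeries.rename _ (MvPowerSeries.X 0)) = X
  rw [MvPowerSeries.rename_X]
  exact MvPowerSeries.optionEquivLeft_X_none

theorem iteratedEquiv_X_one : iteratedEquiv (MvPowerSeries.X 1) = C X := by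
  rw [iteratedEquiv, AlgEquiv.trans_apply]
  change MvPowerSeries.optionEquivLeft Unit ℂ (MvPowerSeries.rename _ (MvPowerSeries.X 1)) = C X
  rw [MvPowerSeries.rename_X]
  exact MvPowerSeries.optionEquivLeft_X_some ()

theorem hasSubst_shear (c : ℂ) : MvPowerSeries.HasSubst
    ![(MvPowerSeries.X 0 : PlaneSeries), MvPowerSeries.X 1 + c • MvPowerSeries.X 0] := by
  refine MvPowerSeries.hasSubst_of_constantCoeff_zero fun i ↦ ?_
  fin_cases i <;> simp

/-- The substitution `f(x, y) ↦ f(x + c y, y)`. -/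
noncomputable def shearHom (c : ℂ) : ℂ⟦X⟧⟦X⟧ →ₐ[ℂ] ℂ⟦X⟧⟦X⟧ :=
  (iteratedEquiv.toAlgHom.comp
    ((MvPowerSeries.substAlgHom (hasSubst_shear c)).restrictScalars ℂ)).comp
    iteratedEquiv.symm.toAlgHom

theorem shearHom_X (c : ℂ) : shearHom c X = X := by
  change iteratedEquiv (MvPowerSeries.substAlgHom (hasSubst_shear c) (iteratedEquiv.symm X)) = X
  rw [← iteratedEquiv_X_zero, iteratedEquiv.symm_apply_apply, MvPowerSeries.substAlgHom_X]
  rfl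

theorem shearHom_C_X (c : ℂ) : shearHom c (C X) = C X + c • X := by
  change iteratedEquiv (MvPowerSeries.substAlgHom (hasSubst_shear c)
    (iteratedEquiv.symm (C X))) = _
  rw [← iteratedEquiv_X_zero, ← iteratedEquiv_X_one, iteratedEquiv.symm_apply_apply,
    MvPowerSeries.substAlgHom_X, ← map_smul, ← map_add]
  rfl

theorem shearHom_comp_neg (c : ℂ) : (shearHom c).comp (shearHom (-c)) = AlgHom.id ℂ _ := by
  refine AlgHom.eq_of_eqOn_generators _ _ (fun a ↦ ⟨_, sub_algebraMap_mem_span_pair a⟩) ?_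
    iInf_maximalIdeal_pow_eq_bot ?_
  · rintro a (rfl | rfl) <;> simp [shearHom_X, shearHom_C_X]
  · rintro a (rfl | rfl) <;> rw [mem_maximalIdeal_iff₂] <;> simp [shearHom_X, shearHom_C_X]

/-- The linear change of coordinates `f(x, y) ↦ f(x + c y, y)`. -/
noncomputable def shear (c : ℂ) : ℂ⟦X⟧⟦X⟧ ≃ₐ[ℂ] ℂ⟦X⟧⟦X⟧ :=
  AlgEquiv.ofAlgHom (shearHom c) (shearHom (-c)) (shearHom_comp_neg c)
    (by simpa using shearHom_comp_neg (-c))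

theorem shear_X (c : ℂ) : shear c X = X := shearHom_X c

theorem shear_C_X (c : ℂ) : shear c (C X) = C X + c • X := shearHom_C_X c

theorem shear_symm_C_X (c : ℂ) : (shear c).symm (C X) = C X - c • X := by
  rw [AlgEquiv.symm_apply_eq, map_sub, map_smul, shear_C_X, shear_X, add_sub_cancel_right]

/-- After a general linear change of coordinates a nonzero series does not vanish on a given
line. -/
theorem exists_restrictY_shear_ne_zero {f : ℂ⟦X⟧⟦X⟧} (hf : f ≠ 0) :
    ∃ c, restrictY (shear c f) ≠ 0 := by
  by_contra! h
  -- Otherwise every line x - cy divides f. As f has finitely many prime factors, two different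
  -- lines would be associated.
  have hprime : ∀ c, Prime ((shear c).symm (C X)) := fun c ↦
    (MulEquiv.prime_iff (shear c).symm).2 prime_C_X
  have hdvd : ∀ c, (shear c).symm (C X) ∣ f := by
    intro c
    obtain ⟨g, hg⟩ := restrictY_eq_zero_iff.1 (h c)
    exact ⟨(shear c).symm g, by rw [← map_mul, ← hg, AlgEquiv.symm_apply_apply]⟩
  choose q hq hqa using fun c ↦
    UniqueFactorizationMonoid.exists_mem_factors_of_dvd hf (hprime c).irreducible (hdvd c)
  classical
  let q' : ℂ → (UniqueFactorizationMonoid.factors f).toFinset := fun c ↦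
    ⟨q c, Multiset.mem_toFinset.2 (hq c)⟩
  obtain ⟨c, c', hcc, heq⟩ := Finite.exists_ne_map_eq_of_infinite q'
  have hassoc : (shear c).symm (C X) ∣ (shear c').symm (C X) := by
    have h1 := hqa c'
    have hqq : q c = q c' := congrArg Subtype.val heq
    rw [← hqq] at h1
    exact ((hqa c).trans h1.symm).dvd
  obtain ⟨g, hg⟩ := hassoc
  -- After the shear by `c` and restriction to x = 0, the divisor x - cy becomes 0 and x - c'y
  -- becomes (c - c')y.
  have h2 := congrArg (fun a ↦ coeff 1 (restrictY (shear c a))) hg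
  simp only [map_mul, restrictY_C, shear_symm_C_X, map_sub, map_smul,
    shear_C_X, shear_X, map_add, restrictY_X] at h2
  simp at h2
  exact hcc (sub_eq_zero.1 h2)

/-- Coordinates in which a given plane curve germ does not contain the line `x = 0`, together with
derivations of the coordinate ring that generate the same ideals as the partial derivatives. -/
theorem exists_coordinates {f : PlaneSeries} (hf : f ≠ 0) :
    ∃ (e : PlaneSeries ≃ₐ[ℂ] ℂ⟦X⟧⟦X⟧) (dx dy : Derivation ℂ ℂ⟦X⟧⟦X⟧ ℂ⟦X⟧⟦X⟧),
      restrictY (e f) ≠ 0 ∧ dx (C X) = 1 ∧ dx X = 0 ∧ dy (C X) = 0 ∧ dy X = 1 ∧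
      ∀ g, milnorNumber g = quotLength ℂ (dx (e g)) (dy (e g)) := by
  obtain ⟨c, hc⟩ := exists_restrictY_shear_ne_zero
    ((map_ne_zero_iff iteratedEquiv iteratedEquiv.injective).2 hf)
  let e := iteratedEquiv.trans (shear c)
  have he0 : e (MvPowerSeries.X 0) = X := by
    rw [AlgEquiv.trans_apply, iteratedEquiv_X_zero, shear_X]
  have he1 : e (MvPowerSeries.X 1) = C X + c • X := by
    rw [AlgEquiv.trans_apply, iteratedEquiv_X_one, shear_C_X]
  have he1' : C X = e (MvPowerSeries.X 1) - c • e (MvPowerSeries.X 0) := by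
    rw [he0, he1, add_sub_cancel_right]
  let d0 := (MvPowerSeries.pderiv ℂ (0 : Fin 2)).conj e
  let d1 := (MvPowerSeries.pderiv ℂ (1 : Fin 2)).conj e
  have h0 : ∀ g, d0 (e g) = e (MvPowerSeries.pderiv ℂ 0 g) := Derivation.conj_apply e _
  have h1 : ∀ g, d1 (e g) = e (MvPowerSeries.pderiv ℂ 1 g) := Derivation.conj_apply e _
  have h0y : d0 X = 1 := by rw [← he0, h0, MvPowerSeries.pderiv_X_self, map_one]
  have h1y : d1 X = 0 := by
    rw [← he0, h1, MvPowerSeries.pderiv_X_of_ne (by decide), map_zero]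
  have h1x : d1 (C X) = 1 := by
    rw [he1', map_sub, Derivation.map_smul, he0, h1y, h1, MvPowerSeries.pderiv_X_self, map_one, smul_zero,
      sub_zero]
  have h0x : d0 (C X) = -c • (1 : ℂ⟦X⟧⟦X⟧) := by
    rw [he1', map_sub, Derivation.map_smul, he0, h0y, h0, MvPowerSeries.pderiv_X_of_ne (by decide),
      map_zero, zero_sub, neg_smul]
  -- As d0 x = -c and d1 x = 1, the correction c · d1 gives a derivation killing x, and it leaves
  -- the ideal of partial derivatives unchanged.
  refine ⟨e, d1, d0 + c • d1, hc, h1x, h1y, ?_, ?_, fun g ↦ ?_⟩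
  · rw [Derivation.add_apply, Derivation.smul_apply, h0x, h1x, neg_smul, neg_add_cancel]
  · rw [Derivation.add_apply, Derivation.smul_apply, h0y, h1y, smul_zero, add_zero]
  · rw [milnorNumber, intersectionNumber_eq_quotLength, ← quotLength_map_algEquiv ℂ e, ← h0,
      ← h1, quotLength_comm, Derivation.add_apply, Derivation.smul_apply,
      Algebra.smul_def, mul_comm, quotLength_add_mul_right]

end PlaneSeries

/-! ### The formula for reduced plane curve germs. -/

theorem mainTheorem12 (f : PlaneSeries)
    (hf_point : MvPowerSeries.constantCoeff f = 0)
    (hf_reduced : Squarefree f)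
    (ℓ : ℕ) (F : Fin ℓ → PlaneSeries)
    (hF_irreducible : ∀ j, Irreducible (F j))
    (hF_prod : f = ∏ j, F j) :
    milnorNumber f ≠ ⊤ ∧
      milnorNumber f + ((ℓ - 1 : ℕ) : ℕ∞) =
        (∑ j, milnorNumber (F j)) +
          2 * ∑ i, ∑ j ∈ Finset.Ioi i, intersectionNumber (F i) (F j) := by
  -- An empty product would be 1, which does not vanish at the point; so the truncated ℓ - 1 is the
  -- true difference.
  have hℓ : ℓ ≠ 0 := by
    rintro rfl
    rw [hF_prod, Fin.prod_univ_zero, map_one] at hf_point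
    exact one_ne_zero hf_point
  obtain ⟨e, dx, dy, hreg, hxx, hxy, hyx, hyy, hμ⟩ :=
    PlaneSeries.exists_coordinates hf_reduced.ne_zero
  have hprod : e f = ∏ j, e (F j) := by rw [hF_prod, map_prod]
  have hprime : ∀ j, Prime (e (F j)) := fun j ↦
    ((MulEquiv.irreducible_iff e).2 (hF_irreducible j)).prime
  have hdvd : ∀ i j, i ≠ j → ¬ e (F i) ∣ e (F j) := by
    intro i j hij h
    have h' : F i ∣ F j := (map_dvd_iff e).1 h
    -- If F_i divided another F_j, then F_i² would divide the squarefree f.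
    refine (hF_irreducible i).not_isUnit (hf_reduced (F i) ?_)
    rw [hF_prod, ← Finset.mul_prod_erase Finset.univ F (Finset.mem_univ i)]
    exact mul_dvd_mul_left _ (h'.trans (Finset.dvd_prod_of_mem F (by simp [hij.symm])))
  have hi : ∀ i j, intersectionNumber (F i) (F j) = quotLength ℂ (e (F i)) (e (F j)) :=
    fun i j ↦ by rw [quotLength_map_algEquiv, intersectionNumber_eq_quotLength]
  simp only [hμ, hi, hprod]
  exact PowerSeries.quotLength_derivation_prod_add dx dy hxx hxy hyx hyy hℓ _ hprime hdvd (hprod ▸ hreg)
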